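/- \textbf{Categories.} A (small) $*$-category is a category with an involution $f\mapsto f^*$ on morphisms that fixes objects and satisfies $f^{**}=f$, $\mathrm{id}^*=\mathrm{id}$, $(fg)^*=g^*f^*$. A $\mathbb C$-linear $*$-category is a $*$-category enriched in complex vector spaces whose involution is antilinear. The maximal norm of a morphism $f$ of a $\mathbb C$-linear $*$-category $\mathbf A$ is $\|f\|_{\max}=\sup_\rho\|\rho(f)\|\in[0,\infty]$, where $\rho$ runs over the representations of $\mathbf A$ in (not necessarily unital) $C^*$-algebras, i.e. families of linear maps $\mathrm{Hom}_{\mathbf A}(a,a')\to B$ compatible with composition and $*$. A pre-$C^*$-category is a $\mathbb C$-linear $*$-category all of whose morphisms have finite maximal norm; a $C^*$-category is a pre-$C^*$-category whose morphism spaces are Banach spaces for the maximal norm. Morphisms are the functors that preserve $*$ (and are $\mathbb C$-linear in the last three cases). A morphism $u\colon a\to a'$ is unitary if $u^*u=\mathrm{id}_a$ and $uu^*=\mathrm{id}_{a'}$. A marking is a set of unitary morphisms which contains all identities and is closed under composition and $*$; morphisms of marked categories preserve marked morphisms. Let $\mathcal C$ be one of the following eight categories: $*$-categories, $\mathbb C$-linear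 $*$-categories, pre-$C^*$-categories, $C^*$-categories, or the category of marked objects of one of these. \textbf{Model-categorical notions.} A weak equivalence of $\mathcal C$ is a morphism $f\colon\mathbf A\to\mathbf B$ for which there is a morphism $g\colon\mathbf B\to\mathbf A$ of $\mathcal C$ such that $fg$ and $gf$ are isomorphic to the identities by natural transformations with unitary (in the marked cases: marked) components. A cofibration of $\mathcal C$ is a morphism that is injective on objects. For a small category $I$, the weak equivalences and cofibrations of the injective model structure on $\mathrm{Fun}(I,\mathcal C)$ are the objectwise ones, and its fibrations are the morphisms with the right lifting property with respect to all morphisms that are both cofibrations and weak equivalences. An object is fibrant if its morphism to a final object is a fibration. \textbf{Functor categories.} Let $\mathbb G$ be a groupoid and $\mathbf A\in\mathcal C$. Let $\mathcal Fun^u(\mathbb G,\mathbf A)$ be the category of functors $\mathbb G\to\mathbf A$ all of whose values on morphisms are unitary (in the marked cases: marked), with all natural transformations as morphisms and the componentwise involution (and linear structure); in the marked cases a transformation is marked if all its components are. For a $\mathbb C$-linear $*$-category $\mathbf X$ let $\mathrm{Bd}(\mathbf X)\subseteq\mathbf X$ be the subcategory with the same objects and the morphisms of finite maximal norm, and $\mathrm{Bd}^\infty(\mathbf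 X)=\bigcap_n\mathrm{Bd}^n(\mathbf X)$, with the marked morphisms of $\mathbf X$ in the marked case. For a pre-$C^*$-category $\mathbf X$ let $\mathrm{Compl}(\mathbf X)$ be the $C^*$-category with the same objects whose morphism spaces are the Hausdorff completions in the maximal norm; in the marked case its marked morphisms are the images of those of $\mathbf X$. Set $$\mathcal Fun^{?}(\mathbb G,\mathbf A)=\begin{cases}\mathcal Fun^u(\mathbb G,\mathbf A)&\text{for (marked) }*\text{- and }\mathbb C\text{-linear }*\text{-categories},\\ \mathrm{Bd}^\infty(\mathcal Fun^u(\mathbb G,\mathbf A))&\text{for (marked) pre-}C^*\text{-categories},\\ \mathrm{Compl}(\mathrm{Bd}^\infty(\mathcal Fun^u(\mathbb G,\mathbf A)))&\text{for (marked) }C^*\text{-categories}.\end{cases}$$ \textbf{The replacement.} Let $G$ be a group, $BG$ the groupoid with one object and automorphism group $G$, and $\tilde G$ the groupoid with object set $G$ and exactly one morphism between any two objects, on which $G$ acts by left multiplication. For $\mathbf A\in\mathrm{Fun}(BG,\mathcal C)$, i.e. an object of $\mathcal C$ with $G$-action, let $G$ act on $\mathcal Fun^?(\tilde G,\mathbf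 A)$ by the action induced from $a\mapsto g\circ a\circ g^{-1}$. This defines a functor $\mathcal Fun^?(\tilde G,-)\colon\mathrm{Fun}(BG,\mathcal C)\to\mathrm{Fun}(BG,\mathcal C)$. The $G$-equivariant functor $\tilde G\to *$ induces a natural transformation $r\colon\mathrm{id}\to\mathcal Fun^?(\tilde G,-)$, which sends an object of $\mathbf A$ to the constant functor with this value. \textbf{Proposition.} In each of the eight cases, $\mathcal Fun^?(\tilde G,-)$ together with $r$ is a fibrant replacement functor for the injective model structure on $\mathrm{Fun}(BG,\mathcal C)$: for every $\mathbf A$ in $\mathrm{Fun}(BG,\mathcal C)$ the morphism $r_{\mathbf A}\colon\mathbf A\to\mathcal Fun^?(\tilde G,\mathbf A)$ is a weak equivalence, and $\mathcal Fun^?(\tilde G,\mathbf A)$ is fibrant. -/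

import Mathlib

open CategoryTheory
set_option linter.checkUnivs false
attribute [-instance] CategoryTheory.catToReflQuiver

universe v u v₁ u₁ v₂ u₂ w

/-- A `*`-category: a category with an involution `*` which is the identity on objects. -/
class StarCategory (A : Type u) [Category.{v} A] where
  /-- The involution `f ↦ f*`. -/
  dag : ∀ {a b : A}, (a ⟶ b) → (b ⟶ a)
  dag_dag : ∀ {a b : A} (f : a ⟶ b), dag (dag f) = f
  dag_id : ∀ a : A, dag (𝟙 a) = 𝟙 a
  dag_comp : ∀ {a b c : A} (f : a ⟶ b) (g : b ⟶ c), dag (f ≫ g) = dag g ≫ dag f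

/-- A `ℂ`-linear `*`-category: a `*`-category enriched in complex vector spaces whose
involution is antilinear. -/
class CLinStarCategory (A : Type u) [Category.{v} A] extends
    Preadditive A, Linear ℂ A, StarCategory A where
  dag_add : ∀ {a b : A} (f g : a ⟶ b), dag (f + g) = dag f + dag g
  dag_smul : ∀ {a b : A} (c : ℂ) (f : a ⟶ b), dag (c • f) = (starRingEnd ℂ c) • dag f

open StarCategory (dag)

/-- Unitary morphisms. -/
def IsUnitary {A : Type u} [Category.{v} A] [StarCategory A] {a b : A} (f : a ⟶ b) : Prop :=
  f ≫ dag f = 𝟙 a ∧ dag f ≫ f = 𝟙 b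

/-- A marking: a set of unitary morphisms containing the identities and closed under
composition and the involution. -/
structure Marking (A : Type u) [Category.{v} A] [StarCategory A] where
  marked : ∀ {a b : A}, (a ⟶ b) → Prop
  unitary : ∀ {a b : A} (f : a ⟶ b), marked f → IsUnitary f
  id : ∀ a : A, marked (𝟙 a)
  comp : ∀ {a b c : A} (f : a ⟶ b) (g : b ⟶ c), marked f → marked g → marked (f ≫ g)
  star : ∀ {a b : A} (f : a ⟶ b), marked f → marked (dag f)

section Basic

variable {A : Type u} [Category.{v} A] [StarCategory A]

theorem IsUnitary.id (a : A) : IsUnitary (𝟙 a) := by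
  simp [IsUnitary, StarCategory.dag_id]

theorem IsUnitary.comp {a b c : A} {f : a ⟶ b} {g : b ⟶ c} (hf : IsUnitary f)
    (hg : IsUnitary g) : IsUnitary (f ≫ g) := by
  constructor
  · rw [StarCategory.dag_comp, Category.assoc, ← Category.assoc g, hg.1, Category.id_comp, hf.1]
  · rw [StarCategory.dag_comp, Category.assoc, ← Category.assoc _ f, hf.2, Category.id_comp, hg.2]

theorem IsUnitary.star {a b : A} {f : a ⟶ b} (hf : IsUnitary f) : IsUnitary (dag f) := by
  constructor
  · rw [StarCategory.dag_dag]; exact hf.2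
  · rw [StarCategory.dag_dag]; exact hf.1

/-- The maximal marking: all unitary morphisms are marked. -/
def Marking.max (A : Type u) [Category.{v} A] [StarCategory A] : Marking A where
  marked f := IsUnitary f
  unitary _ h := h
  id a := IsUnitary.id a
  comp _ _ hf hg := hf.comp hg
  star _ hf := hf.star

end Basic

/-! ### Morphisms -/

/-- Functors preserving the involution. -/
structure StarFunctor (A : Type u₁) [Category.{v₁} A] [StarCategory A]
    (B : Type u₂) [Category.{v₂} B] [StarCategory B] extends A ⥤ B where
  map_star : ∀ {a b : A} (f : a ⟶ b), map (dag f) = dag (map f)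

/-- Functors preserving the involution and the `ℂ`-linear structure. -/
structure CLinStarFunctor (A : Type u₁) [Category.{v₁} A] [CLinStarCategory A]
    (B : Type u₂) [Category.{v₂} B] [CLinStarCategory B] extends StarFunctor A B where
  map_add : ∀ {a b : A} (f g : a ⟶ b), map (f + g) = map f + map g
  map_smul : ∀ {a b : A} (c : ℂ) (f : a ⟶ b), map (c • f) = c • map f

theorem StarFunctor.ext' {A : Type u₁} [Category.{v₁} A] [StarCategory A]
    {B : Type u₂} [Category.{v₂} B] [StarCategory B] {F G : StarFunctor A B}
    (h : F.toFunctor = G.toFunctor) : F = G := by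
  cases F; cases G; cases h; rfl

theorem CLinStarFunctor.ext' {A : Type u₁} [Category.{v₁} A] [CLinStarCategory A]
    {B : Type u₂} [Category.{v₂} B] [CLinStarCategory B] {F G : CLinStarFunctor A B}
    (h : F.toFunctor = G.toFunctor) : F = G := by
  obtain ⟨F, _, _⟩ := F; obtain ⟨G, _, _⟩ := G
  have : F = G := StarFunctor.ext' h
  subst this; rfl

/-! ### The categories of (marked) (`ℂ`-linear) `*`-categories -/

/-- The category of small `*`-categories (objects in `Type u`, morphisms in `Type v`). -/
structure StarCat where
  carrier : Type u
  [cat : Category.{v} carrier]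
  [str : StarCategory carrier]

attribute [instance] StarCat.cat StarCat.str

instance : Category StarCat.{v, u} where
  Hom A B := StarFunctor A.carrier B.carrier
  id A := { 𝟭 A.carrier with map_star := fun _ => rfl }
  comp F G := { F.toFunctor ⋙ G.toFunctor with
    map_star := fun f => by simp [F.map_star, G.map_star] }

/-- The category of small marked `*`-categories. -/
structure MStarCat where
  carrier : Type u
  [cat : Category.{v} carrier]
  [str : StarCategory carrier]
  marking : Marking carrier

attribute [instance] MStarCat.cat MStarCat.str

/-- Morphisms of marked `*`-categories preserve marked morphisms. -/
structure MStarCat.Hom (A : MStarCat.{v₁, u₁}) (B : MStarCat.{v₂, u₂}) extends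
    StarFunctor A.carrier B.carrier where
  map_marked : ∀ {a b : A.carrier} (f : a ⟶ b), A.marking.marked f → B.marking.marked (map f)

instance : Category MStarCat.{v, u} where
  Hom A B := MStarCat.Hom A B
  id A := { 𝟭 A.carrier with map_star := fun _ => rfl, map_marked := fun _ h => h }
  comp F G := { F.toFunctor ⋙ G.toFunctor with
    map_star := fun f => by simp [F.map_star, G.map_star]
    map_marked := fun f h => G.map_marked _ (F.map_marked f h) }

theorem MStarCat.hom_ext {A B : MStarCat.{v, u}} {F G : A ⟶ B}
    (h : F.toFunctor = G.toFunctor) : F = G := by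
  obtain ⟨F, _⟩ := F; obtain ⟨G, _⟩ := G
  have : F = G := StarFunctor.ext' h
  subst this; rfl

/-- The category of small `ℂ`-linear `*`-categories. -/
structure CLinStarCat where
  carrier : Type u
  [cat : Category.{v} carrier]
  [str : CLinStarCategory carrier]

attribute [instance] CLinStarCat.cat CLinStarCat.str

instance : Category CLinStarCat.{v, u} where
  Hom A B := CLinStarFunctor A.carrier B.carrier
  id A := { 𝟭 A.carrier with
    map_star := fun _ => rfl, map_add := fun _ _ => rfl, map_smul := fun _ _ => rfl }
  comp F G := { F.toFunctor ⋙ G.toFunctor with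
    map_star := fun f => by simp [F.map_star, G.map_star]
    map_add := fun f g => by simp [F.map_add, G.map_add]
    map_smul := fun c f => by simp [F.map_smul, G.map_smul] }

/-- The category of small marked `ℂ`-linear `*`-categories. -/
structure MCLinStarCat where
  carrier : Type u
  [cat : Category.{v} carrier]
  [str : CLinStarCategory carrier]
  marking : Marking carrier

attribute [instance] MCLinStarCat.cat MCLinStarCat.str

/-- Morphisms of marked `ℂ`-linear `*`-categories preserve marked morphisms. -/
structure MCLinStarCat.Hom (A : MCLinStarCat.{v₁, u₁}) (B : MCLinStarCat.{v₂, u₂}) extends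
    CLinStarFunctor A.carrier B.carrier where
  map_marked : ∀ {a b : A.carrier} (f : a ⟶ b), A.marking.marked f → B.marking.marked (map f)

instance : Category MCLinStarCat.{v, u} where
  Hom A B := MCLinStarCat.Hom A B
  id A := { 𝟭 A.carrier with
    map_star := fun _ => rfl, map_add := fun _ _ => rfl, map_smul := fun _ _ => rfl
    map_marked := fun _ h => h }
  comp F G := { F.toFunctor ⋙ G.toFunctor with
    map_star := fun f => by simp [F.map_star, G.map_star]
    map_add := fun f g => by simp [F.map_add, G.map_add]
    map_smul := fun c f => by simp [F.map_smul, G.map_smul]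
    map_marked := fun f h => G.map_marked _ (F.map_marked f h) }

theorem MCLinStarCat.hom_ext {A B : MCLinStarCat.{v, u}} {F G : A ⟶ B}
    (h : F.toFunctor = G.toFunctor) : F = G := by
  obtain ⟨F, _⟩ := F; obtain ⟨G, _⟩ := G
  have : F = G := CLinStarFunctor.ext' h
  subst this; rfl

/-- Forget the marking. -/
def MStarCat.forget : MStarCat.{v, u} ⥤ StarCat.{v, u} where
  obj A := ⟨A.carrier⟩
  map F := F.toStarFunctor

/-- Mark all unitaries. -/
def StarCat.ma : StarCat.{v, u} ⥤ MStarCat.{v, u} where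
  obj A := ⟨A.carrier, Marking.max A.carrier⟩
  map {A B} F := { F with
    map_marked := fun {a b} f (h : IsUnitary f) => show IsUnitary (F.map f) from by
      constructor
      · rw [← F.map_star, ← F.map_comp, h.1, F.map_id]
      · rw [← F.map_star, ← F.map_comp, h.2, F.map_id] }

/-- Forget the marking. -/
def MCLinStarCat.forget : MCLinStarCat.{v, u} ⥤ CLinStarCat.{v, u} where
  obj A := ⟨A.carrier⟩
  map F := F.toCLinStarFunctor

/-- Mark all unitaries. -/
def CLinStarCat.ma : CLinStarCat.{v, u} ⥤ MCLinStarCat.{v, u} where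
  obj A := ⟨A.carrier, Marking.max A.carrier⟩
  map {A B} F := { F with
    map_marked := fun {a b} f (h : IsUnitary f) => show IsUnitary (F.map f) from by
      constructor
      · rw [← F.map_star, ← F.map_comp, h.1, F.map_id]
      · rw [← F.map_star, ← F.map_comp, h.2, F.map_id] }

/-- Forget the `ℂ`-linear structure of a marked `ℂ`-linear `*`-category. -/
def MCLinStarCat.toMStarCat : MCLinStarCat.{v, u} ⥤ MStarCat.{v, u} where
  obj A := ⟨A.carrier, A.marking⟩
  map F := { F.toStarFunctor with map_marked := F.map_marked }


/-! ### Categories of (marked) unitary functors -/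

/-- The objects of `Fun^u(K, A)`: functors from `K` to `A` all of whose values on morphisms
are marked. -/
structure UFun (K : Type u₂) [Category.{v₂} K] {A : Type u} [Category.{v} A]
    [StarCategory A] (M : Marking A) where
  toFunctor : K ⥤ A
  marked : ∀ {g h : K} (φ : g ⟶ h), M.marked (toFunctor.map φ)

namespace UFun

section Star

variable {K : Type u₂} [Category.{v₂} K] {A : Type u} [Category.{v} A]
  [StarCategory A] {M : Marking A}

instance : Category (UFun K M) where
  Hom a b := a.toFunctor ⟶ b.toFunctor
  id a := 𝟙 a.toFunctor
  comp f g := NatTrans.vcomp f g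

/-- The involution is taken componentwise. -/
instance : StarCategory (UFun K M) where
  dag {a b} f :=
    { app := fun g => dag (NatTrans.app f g)
      naturality := fun g h φ => by
        have ha := M.unitary _ (a.marked φ)
        have hb := M.unitary _ (b.marked φ)
        have e := congrArg dag (NatTrans.naturality f φ)
        rw [StarCategory.dag_comp, StarCategory.dag_comp] at e
        calc b.toFunctor.map φ ≫ dag (NatTrans.app f h)
            = b.toFunctor.map φ ≫ (dag (NatTrans.app f h) ≫ dag (a.toFunctor.map φ)) ≫
                a.toFunctor.map φ := by
              rw [Category.assoc, ha.2, Category.comp_id]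
          _ = dag (NatTrans.app f g) ≫ a.toFunctor.map φ := by
              rw [e, ← Category.assoc, ← Category.assoc, hb.1, Category.id_comp] }
  dag_dag f := NatTrans.ext (funext fun _ => StarCategory.dag_dag _)
  dag_id a := NatTrans.ext (funext fun _ => StarCategory.dag_id _)
  dag_comp f g := NatTrans.ext (funext fun _ => StarCategory.dag_comp _ _)

/-- A transformation is marked if all its components are marked. -/
def marking (K : Type u₂) [Category.{v₂} K] {A : Type u} [Category.{v} A]
    [StarCategory A] (M : Marking A) : Marking (UFun K M) where
  marked f := ∀ g : K, M.marked (NatTrans.app f g)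
  unitary _ hf := ⟨NatTrans.ext (funext fun g => (M.unitary _ (hf g)).1),
    NatTrans.ext (funext fun g => (M.unitary _ (hf g)).2)⟩
  id _ _ := M.id _
  comp _ _ hf hh g := M.comp _ _ (hf g) (hh g)
  star _ hf g := M.star _ (hf g)

end Star

instance {K : Type u₂} [Category.{v₂} K] {A : Type u} [Category.{v} A]
    [CLinStarCategory A] {M : Marking A} : CLinStarCategory (UFun K M) where
  homGroup a b := inferInstanceAs (AddCommGroup (a.toFunctor ⟶ b.toFunctor))
  add_comp _ _ _ f f' g := Preadditive.add_comp (C := K ⥤ A) _ _ _ f f' g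
  comp_add _ _ _ f g g' := Preadditive.comp_add (C := K ⥤ A) _ _ _ f g g'
  homModule a b := inferInstanceAs (Module ℂ (a.toFunctor ⟶ b.toFunctor))
  smul_comp _ _ _ r f g := Linear.smul_comp (C := K ⥤ A) _ _ _ r f g
  comp_smul _ _ _ f r g := Linear.comp_smul (C := K ⥤ A) _ _ _ f r g
  toStarCategory := inferInstance
  dag_add _ _ := NatTrans.ext (funext fun _ => CLinStarCategory.dag_add _ _)
  dag_smul _ _ := NatTrans.ext (funext fun _ => CLinStarCategory.dag_smul _ _)

end UFun

theorem UFun.ext' {K : Type u₂} [Category.{v₂} K] {A : Type u} [Category.{v} A]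
    [StarCategory A] {M : Marking A} {a b : UFun K M} (h : a.toFunctor = b.toFunctor) :
    a = b := by
  cases a; cases b; cases h; rfl

theorem UFun.eqToHom_comp_app {K : Type u₂} [Category.{v₂} K] {A : Type u} [Category.{v} A]
    [StarCategory A] {M : Marking A} {a a' b b' : UFun K M} (h : a = a') (h' : b' = b)
    (f : a' ⟶ b') (g : K) :
    NatTrans.app (eqToHom h ≫ f ≫ eqToHom h' : a ⟶ b) g =
      eqToHom (by rw [h]) ≫ NatTrans.app f g ≫ eqToHom (by rw [h']) := by
  subst h; subst h'
  rw [eqToHom_refl, eqToHom_refl, Category.id_comp, Category.comp_id]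
  simp

theorem UFun.const_comp_obj {K : Type u₂} [Category.{v₂} K] {A : Type u} [Category.{v} A]
    {B : Type u₁} [Category.{v₁} B] (F : A ⥤ B) (a : A) :
    (Functor.const K).obj (F.obj a) = 𝟭 K ⋙ (Functor.const K).obj a ⋙ F :=
  CategoryTheory.Functor.ext (fun _ => rfl) (fun _ _ _ => by simp)

/-- `Fun^u(p, F)`, sending a functor `a` to `F ∘ a ∘ p`. -/
def MStarCat.uFunMap {K : Type u₁} [Category.{v₁} K] {L : Type u₂} [Category.{v₂} L]
    (p : L ⥤ K) {A B : MStarCat.{v, u}} (F : A ⟶ B) :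
    MStarCat.Hom ⟨UFun K A.marking, UFun.marking K A.marking⟩
      ⟨UFun L B.marking, UFun.marking L B.marking⟩ where
  obj a := ⟨p ⋙ a.toFunctor ⋙ F.toFunctor, fun φ => F.map_marked _ (a.marked _)⟩
  map {a b} f :=
    { app := fun g => F.map (NatTrans.app f (p.obj g))
      naturality := fun g h φ => by
        dsimp
        rw [← F.map_comp, ← F.map_comp, NatTrans.naturality] }
  map_id a := NatTrans.ext (funext fun _ => F.map_id _)
  map_comp f g := NatTrans.ext (funext fun _ => F.map_comp _ _)
  map_star f := NatTrans.ext (funext fun _ => F.map_star _)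
  map_marked f hf g := F.map_marked _ (hf _)

/-- `Fun^u(p, F)`, sending a functor `a` to `F ∘ a ∘ p`. -/
def MCLinStarCat.uFunMap {K : Type u₁} [Category.{v₁} K] {L : Type u₂} [Category.{v₂} L]
    (p : L ⥤ K) {A B : MCLinStarCat.{v, u}} (F : A ⟶ B) :
    MCLinStarCat.Hom ⟨UFun K A.marking, UFun.marking K A.marking⟩
      ⟨UFun L B.marking, UFun.marking L B.marking⟩ where
  obj a := ⟨p ⋙ a.toFunctor ⋙ F.toFunctor, fun φ => F.map_marked _ (a.marked _)⟩
  map {a b} f :=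
    { app := fun g => F.map (NatTrans.app f (p.obj g))
      naturality := fun g h φ => by
        dsimp
        rw [← F.map_comp, ← F.map_comp, NatTrans.naturality] }
  map_id a := NatTrans.ext (funext fun _ => F.map_id _)
  map_comp f g := NatTrans.ext (funext fun _ => F.map_comp _ _)
  map_star f := NatTrans.ext (funext fun _ => F.map_star _)
  map_add f g := NatTrans.ext (funext fun _ => F.map_add _ _)
  map_smul c f := NatTrans.ext (funext fun _ => F.map_smul _ _)
  map_marked f hf g := F.map_marked _ (hf _)

/-- The morphism `A ≅ Fun^u(*, A) ⟶ Fun^u(K, A)` induced by `K ⟶ *`, sending an object to the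
constant functor. -/
def MStarCat.const (K : Type u₂) [Category.{v₂} K] (A : MStarCat.{v, u}) :
    MStarCat.Hom A ⟨UFun K A.marking, UFun.marking K A.marking⟩ where
  obj x := ⟨(Functor.const K).obj x, fun _ => A.marking.id x⟩
  map f := (Functor.const K).map f
  map_id _ := rfl
  map_comp _ _ := rfl
  map_star _ := rfl
  map_marked _ hf _ := hf

/-- The morphism `A ≅ Fun^u(*, A) ⟶ Fun^u(K, A)` induced by `K ⟶ *`, sending an object to the
constant functor. -/
def MCLinStarCat.const (K : Type u₂) [Category.{v₂} K] (A : MCLinStarCat.{v, u}) :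
    MCLinStarCat.Hom A ⟨UFun K A.marking, UFun.marking K A.marking⟩ where
  obj x := ⟨(Functor.const K).obj x, fun _ => A.marking.id x⟩
  map f := (Functor.const K).map f
  map_id _ := rfl
  map_comp _ _ := rfl
  map_star _ := rfl
  map_add _ _ := rfl
  map_smul _ _ := rfl
  map_marked _ hf _ := hf

/-! ### The contractible groupoid on a group -/

/-- The groupoid with object set `G` and exactly one morphism between any two objects. -/
structure GTilde (G : Type v) : Type v where
  el : G

instance (G : Type v) : Groupoid.{v} (GTilde G) where
  Hom _ _ := PUnit.{v + 1}
  id _ := ⟨⟩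
  comp _ _ := ⟨⟩
  inv _ := ⟨⟩

/-- The action of the group on its contractible groupoid by left multiplication. -/
def GTilde.leftMul {G : Type v} [Group G] (g : G) : GTilde G ⥤ GTilde G where
  obj x := ⟨g * x.el⟩
  map _ := ⟨⟩

theorem GTilde.leftMul_one (G : Type v) [Group G] :
    GTilde.leftMul (1 : G) = 𝟭 (GTilde G) :=
  CategoryTheory.Functor.ext (fun x => by simp [GTilde.leftMul]) (fun _ _ _ => rfl)

theorem GTilde.leftMul_mul {G : Type v} [Group G] (g h : G) :
    GTilde.leftMul (g * h) = GTilde.leftMul h ⋙ GTilde.leftMul g :=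
  CategoryTheory.Functor.ext (fun x => by simp [GTilde.leftMul, mul_assoc]) (fun _ _ _ => rfl)

theorem MStarCat.const_naturality (G : Type v) {A B : MStarCat.{v, max v u}} (F : A ⟶ B) :
    CategoryStruct.comp (obj := MStarCat.{v, max v u}) F (MStarCat.const (GTilde G) B) =
      CategoryStruct.comp (obj := MStarCat.{v, max v u}) (MStarCat.const (GTilde G) A)
        (MStarCat.uFunMap (𝟭 (GTilde G)) F) := by
  refine MStarCat.hom_ext (CategoryTheory.Functor.ext
    (fun a => UFun.ext' (UFun.const_comp_obj F.toFunctor a)) (fun a b f => ?_))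
  refine NatTrans.ext (funext fun g => ?_)
  refine Eq.trans ?_ (UFun.eqToHom_comp_app _ _ _ g).symm
  exact ((Category.id_comp _).trans (Category.comp_id _)).symm

theorem MCLinStarCat.const_naturality (G : Type v) {A B : MCLinStarCat.{v, max v u}} (F : A ⟶ B) :
    CategoryStruct.comp (obj := MCLinStarCat.{v, max v u}) F (MCLinStarCat.const (GTilde G) B) =
      CategoryStruct.comp (obj := MCLinStarCat.{v, max v u}) (MCLinStarCat.const (GTilde G) A)
        (MCLinStarCat.uFunMap (𝟭 (GTilde G)) F) := by
  refine MCLinStarCat.hom_ext (CategoryTheory.Functor.ext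
    (fun a => UFun.ext' (UFun.const_comp_obj F.toFunctor a)) (fun a b f => ?_))
  refine NatTrans.ext (funext fun g => ?_)
  refine Eq.trans ?_ (UFun.eqToHom_comp_app _ _ _ g).symm
  exact ((Category.id_comp _).trans (Category.comp_id _)).symm

/-! ### Functors with a compatible action -/

/-- An endofunctor `F` of `C` with an action of `G` by natural transformations, together with
an invariant natural transformation from the identity to `F`. -/
structure GFunctor (G : Type v) [Group G] (C : Type u) [Category.{w} C] where
  act : SingleObj G ⥤ (C ⥤ C)
  unit : (Functor.const (SingleObj G)).obj (𝟭 C) ⟶ act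

namespace GFunctor

variable {G : Type v} [Group G] {C : Type u} [Category.{w} C] (T : GFunctor G C)

/-- The induced endofunctor of the category of `G`-objects: it sends `X` to `F(X)`, and the group
element `g` acts on `F(X)` by the composite of the action of `g` on `F` and of `F(g)`. -/
def onGObjects : (SingleObj G ⥤ C) ⥤ (SingleObj G ⥤ C) where
  obj X :=
    { obj := fun i => (T.act.obj i).obj (X.obj i)
      map := fun {i j} g => (T.act.map g).app (X.obj i) ≫ (T.act.obj j).map (X.map g)
      map_id := fun i => by simp
      map_comp := fun g h => by simp }
  map f :=
    { app := fun i => (T.act.obj i).map (f.app i)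
      naturality := fun i j g => by
        simp only [Category.assoc, ← Functor.map_comp, f.naturality]
        simp }

/-- The induced natural transformation from the identity on the category of `G`-objects. -/
def unitOnGObjects : 𝟭 (SingleObj G ⥤ C) ⟶ T.onGObjects where
  app X :=
    { app := fun i => (T.unit.app i).app (X.obj i)
      naturality := fun i j g => by
        have h := congrArg (fun α => NatTrans.app α (X.obj i)) (T.unit.naturality g)
        simp only [Functor.const_obj_obj, Functor.const_obj_map, NatTrans.comp_app] at h
        have h' := (T.unit.app j).naturality (X.map g)
        simp only [Functor.const_obj_obj, Functor.id_map] at h'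
        dsimp [onGObjects]
        rw [h', ← Category.assoc, ← h]
        simp }
  naturality X Y f := by
    ext i
    exact (T.unit.app i).naturality (f.app i)

/-- Conjugation along functors `L : C ⥤ D`, `R : D ⥤ C` and a transformation
`η : 𝟭 C ⟶ L ⋙ R`. -/
def conj {D : Type u₁} [Category.{v₁} D] (T : GFunctor G D) (L : C ⥤ D) (R : D ⥤ C)
    (η : 𝟭 C ⟶ L ⋙ R) : GFunctor G C where
  act :=
    { obj := fun i => L ⋙ T.act.obj i ⋙ R
      map := fun g => Functor.whiskerLeft L (Functor.whiskerRight (T.act.map g) R)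
      map_id := fun i => by ext; simp
      map_comp := fun g h => by ext; simp }
  unit :=
    { app := fun i => η ≫ Functor.whiskerLeft L (Functor.whiskerRight (T.unit.app i) R)
      naturality := fun i j g => by
        ext X
        have h := congrArg (fun α => NatTrans.app α (L.obj X)) (T.unit.naturality g)
        simp only [Functor.const_obj_obj, Functor.const_obj_map, NatTrans.comp_app] at h
        simp [← Functor.map_comp, ← h] }

end GFunctor

/-- `Fun^u` of the contractible groupoid on `G`, for marked `*`-categories. A group element `g`
acts by sending `a` to `a ∘ g⁻¹`. -/
def MStarCat.funTilde (G : Type v) [Group G] : GFunctor G MStarCat.{v, max v u} where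
  act :=
    { obj := fun _ =>
        { obj := fun A => ⟨UFun (GTilde G) A.marking, UFun.marking _ A.marking⟩
          map := fun F => MStarCat.uFunMap (𝟭 (GTilde G)) F
          map_id := fun _ => rfl
          map_comp := fun _ _ => rfl }
      map := fun g =>
        { app := fun A => MStarCat.uFunMap (GTilde.leftMul (g : G)⁻¹) (𝟙 A)
          naturality := fun _ _ _ => rfl }
      map_id := fun _ => by
        ext A
        have : GTilde.leftMul ((1 : G)⁻¹) = 𝟭 (GTilde G) := by
          rw [inv_one, GTilde.leftMul_one]
        change MStarCat.uFunMap (GTilde.leftMul ((1 : G)⁻¹)) (𝟙 A) = _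
        rw [this]
        rfl
      map_comp := fun g h => by
        ext A
        have : GTilde.leftMul (((h : G) * (g : G))⁻¹) =
            GTilde.leftMul (h : G)⁻¹ ⋙ GTilde.leftMul (g : G)⁻¹ := by
          rw [mul_inv_rev, GTilde.leftMul_mul]
        change MStarCat.uFunMap (GTilde.leftMul (((h : G) * (g : G))⁻¹)) (𝟙 A) = _
        rw [this]
        rfl }
  unit :=
    { app := fun _ =>
        { app := fun A => MStarCat.const (GTilde G) A
          naturality := fun _ _ F => MStarCat.const_naturality G F }
      naturality := fun _ _ _ => by
        ext A
        exact MStarCat.hom_ext rfl }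

/-- `Fun^u` of the contractible groupoid on `G`, for marked `ℂ`-linear `*`-categories. A group
element `g` acts by sending `a` to `a ∘ g⁻¹`. -/
def MCLinStarCat.funTilde (G : Type v) [Group G] : GFunctor G MCLinStarCat.{v, max v u} where
  act :=
    { obj := fun _ =>
        { obj := fun A => ⟨UFun (GTilde G) A.marking, UFun.marking _ A.marking⟩
          map := fun F => MCLinStarCat.uFunMap (𝟭 (GTilde G)) F
          map_id := fun _ => rfl
          map_comp := fun _ _ => rfl }
      map := fun g =>
        { app := fun A => MCLinStarCat.uFunMap (GTilde.leftMul (g : G)⁻¹) (𝟙 A)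
          naturality := fun _ _ _ => rfl }
      map_id := fun _ => by
        ext A
        have : GTilde.leftMul ((1 : G)⁻¹) = 𝟭 (GTilde G) := by
          rw [inv_one, GTilde.leftMul_one]
        change MCLinStarCat.uFunMap (GTilde.leftMul ((1 : G)⁻¹)) (𝟙 A) = _
        rw [this]
        rfl
      map_comp := fun g h => by
        ext A
        have : GTilde.leftMul (((h : G) * (g : G))⁻¹) =
            GTilde.leftMul (h : G)⁻¹ ⋙ GTilde.leftMul (g : G)⁻¹ := by
          rw [mul_inv_rev, GTilde.leftMul_mul]
        change MCLinStarCat.uFunMap (GTilde.leftMul (((h : G) * (g : G))⁻¹)) (𝟙 A) = _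
        rw [this]
        rfl }
  unit :=
    { app := fun _ =>
        { app := fun A => MCLinStarCat.const (GTilde G) A
          naturality := fun _ _ F => MCLinStarCat.const_naturality G F }
      naturality := fun _ _ _ => by
        ext A
        exact MCLinStarCat.hom_ext rfl }

/-- `Fun^u` of the contractible groupoid for `*`-categories: the unitary functors to `A` are the
functors which are marked when all unitaries of `A` are marked. -/
def StarCat.funTilde (G : Type v) [Group G] : GFunctor G StarCat.{v, max v u} :=
  (MStarCat.funTilde.{v, u} G).conj StarCat.ma MStarCat.forget { app := fun A => 𝟙 A }

/-- `Fun^u` of the contractible groupoid for `ℂ`-linear `*`-categories. -/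
def CLinStarCat.funTilde (G : Type v) [Group G] : GFunctor G CLinStarCat.{v, max v u} :=
  (MCLinStarCat.funTilde.{v, u} G).conj CLinStarCat.ma MCLinStarCat.forget { app := fun A => 𝟙 A }


/-! ### The maximal norm, pre-`C*`-categories and `C*`-categories -/

/-- Representations of a `ℂ`-linear `*`-category in a (not necessarily unital) `C*`-algebra. -/
structure CStarRep (A : Type u) [Category.{v} A] [CLinStarCategory A]
    (B : Type w) [NonUnitalCStarAlgebra B] where
  toFun : ∀ {a b : A}, (a ⟶ b) →ₗ[ℂ] B
  map_comp : ∀ {a b c : A} (f : a ⟶ b) (g : b ⟶ c), toFun (f ≫ g) = toFun g * toFun f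
  map_star : ∀ {a b : A} (f : a ⟶ b), toFun (dag f) = star (toFun f)

section MaxNorm

open ENNReal

variable {A : Type u} [Category.{v} A] [CLinStarCategory A]

/-- The maximal norm of a morphism: the supremum of `‖ρ f‖` over all representations `ρ` in
`C*`-algebras. (A universe containing all morphisms of `A` also contains the `C*`-algebras
generated by the images of representations.) -/
noncomputable def maxNorm {a b : A} (f : a ⟶ b) : ℝ≥0∞ :=
  ⨆ (B : Type (max u v)) (_ : NonUnitalCStarAlgebra B) (ρ : CStarRep A B), ‖ρ.toFun f‖ₑ

theorem le_maxNorm {B : Type (max u v)} [NonUnitalCStarAlgebra B] (ρ : CStarRep A B) {a b : A}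
    (f : a ⟶ b) : ‖ρ.toFun f‖ₑ ≤ maxNorm f :=
  le_iSup_of_le B (le_iSup_of_le inferInstance (le_iSup_of_le ρ le_rfl))

theorem maxNorm_le {a b : A} {f : a ⟶ b} {c : ℝ≥0∞}
    (h : ∀ (B : Type (max u v)) [NonUnitalCStarAlgebra B] (ρ : CStarRep A B),
      ‖ρ.toFun f‖ₑ ≤ c) : maxNorm f ≤ c :=
  iSup_le fun B => iSup_le fun _ => iSup_le fun ρ => h B ρ

theorem maxNorm_zero (a b : A) : maxNorm (0 : a ⟶ b) = 0 :=
  le_antisymm (maxNorm_le fun B _ ρ => by simp) bot_le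

theorem maxNorm_add_le {a b : A} (f g : a ⟶ b) : maxNorm (f + g) ≤ maxNorm f + maxNorm g :=
  maxNorm_le fun B _ ρ => by
    rw [map_add]
    exact (enorm_add_le _ _).trans (add_le_add (le_maxNorm ρ f) (le_maxNorm ρ g))

theorem maxNorm_smul_le {a b : A} (c : ℂ) (f : a ⟶ b) : maxNorm (c • f) ≤ ‖c‖ₑ * maxNorm f :=
  maxNorm_le fun B _ ρ => by
    rw [map_smul, enorm_smul]
    exact mul_le_mul_right (le_maxNorm ρ f) _

theorem maxNorm_comp_le {a b c : A} (f : a ⟶ b) (g : b ⟶ c) :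
    maxNorm (f ≫ g) ≤ maxNorm g * maxNorm f :=
  maxNorm_le fun B _ ρ => by
    rw [ρ.map_comp]
    refine le_trans ?_ (mul_le_mul' (le_maxNorm ρ g) (le_maxNorm ρ f))
    rw [← ofReal_norm, ← ofReal_norm, ← ofReal_norm, ← ENNReal.ofReal_mul (norm_nonneg _)]
    exact ENNReal.ofReal_le_ofReal (norm_mul_le _ _)

theorem maxNorm_dag_le {a b : A} (f : a ⟶ b) : maxNorm (dag f) ≤ maxNorm f :=
  maxNorm_le fun B _ ρ => by
    rw [ρ.map_star]
    refine le_trans ?_ (le_maxNorm ρ f)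
    rw [← ofReal_norm, ← ofReal_norm, norm_star]

theorem maxNorm_dag {a b : A} (f : a ⟶ b) : maxNorm (dag f) = maxNorm f :=
  le_antisymm (maxNorm_dag_le f) (by
    simpa [StarCategory.dag_dag] using maxNorm_dag_le (dag f))

theorem maxNorm_unitary_le {a b : A} {f : a ⟶ b} (hf : IsUnitary f) : maxNorm f ≤ 1 :=
  maxNorm_le fun B _ ρ => by
    have h1 : ρ.toFun f * (star (ρ.toFun f) * ρ.toFun f) = ρ.toFun f := by
      rw [← ρ.map_star, ← ρ.map_comp, ← ρ.map_comp, hf.1, Category.id_comp]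
    have h2 : star (ρ.toFun f) * ρ.toFun f * star (star (ρ.toFun f) * ρ.toFun f) =
        star (ρ.toFun f) * ρ.toFun f := by
      rw [star_mul, star_star, mul_assoc, h1]
    have h3 := CStarRing.norm_self_mul_star (x := star (ρ.toFun f) * ρ.toFun f)
    rw [h2, CStarRing.norm_star_mul_self] at h3
    rw [← ofReal_norm, ← ENNReal.ofReal_one]
    refine ENNReal.ofReal_le_ofReal ?_
    nlinarith [norm_nonneg (ρ.toFun f), sq_nonneg (‖ρ.toFun f‖ * ‖ρ.toFun f‖ - 1)]

/-- Composition of a representation with a functor. -/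
def CStarRep.precomp {A' : Type u₁} [Category.{v₁} A'] [CLinStarCategory A']
    (F : CLinStarFunctor A' A) {B : Type w} [NonUnitalCStarAlgebra B] (ρ : CStarRep A B) :
    CStarRep A' B where
  toFun {_ _} :=
    { toFun := fun f => ρ.toFun (F.map f)
      map_add' := fun f g => by rw [F.map_add, map_add]
      map_smul' := fun c f => by rw [F.map_smul, map_smul]; rfl }
  map_comp f g := by
    change ρ.toFun (F.map (f ≫ g)) = _
    rw [F.map_comp, ρ.map_comp]; rfl
  map_star f := by
    change ρ.toFun (F.map (dag f)) = _
    rw [F.map_star, ρ.map_star]; rfl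

theorem maxNorm_map_le {A' : Type u} [Category.{v} A'] [CLinStarCategory A']
    (F : CLinStarFunctor A' A) {a b : A'} (f : a ⟶ b) : maxNorm (F.map f) ≤ maxNorm f :=
  maxNorm_le fun _ _ ρ => le_maxNorm (ρ.precomp F) f

end MaxNorm

/-- A pre-`C*`-category: every morphism has finite maximal norm. -/
class IsPreCStar (A : Type u) [Category.{v} A] [CLinStarCategory A] : Prop where
  maxNorm_lt_top : ∀ {a b : A} (f : a ⟶ b), maxNorm f < ⊤

/-- The morphism spaces of a pre-`C*`-category, seminormed by the maximal norm. -/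
structure NHom {A : Type u} [Category.{v} A] (a b : A) : Type v where
  hom : a ⟶ b

namespace NHom

variable {A : Type u} [Category.{v} A] [CLinStarCategory A] {a b c : A}

def equiv (a b : A) : NHom a b ≃ (a ⟶ b) := ⟨NHom.hom, NHom.mk, fun _ => rfl, fun _ => rfl⟩

instance : AddCommGroup (NHom a b) := (equiv a b).addCommGroup
instance : Module ℂ (NHom a b) := (equiv a b).module ℂ

theorem hom_add (f g : NHom a b) : (f + g).hom = f.hom + g.hom := rfl
theorem hom_smul (c : ℂ) (f : NHom a b) : (c • f).hom = c • f.hom := rfl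

noncomputable instance [IsPreCStar A] : SeminormedAddCommGroup (NHom a b) :=
  AddGroupSeminorm.toSeminormedAddCommGroup
    { toFun := fun f => (maxNorm f.hom).toReal
      map_zero' := by
        change (maxNorm (0 : a ⟶ b)).toReal = 0
        rw [maxNorm_zero]; rfl
      add_le' := fun f g => by
        rw [← ENNReal.toReal_add (IsPreCStar.maxNorm_lt_top _).ne (IsPreCStar.maxNorm_lt_top _).ne]
        exact ENNReal.toReal_mono (ENNReal.add_lt_top.2
          ⟨IsPreCStar.maxNorm_lt_top _, IsPreCStar.maxNorm_lt_top _⟩).ne (maxNorm_add_le _ _)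
      neg' := fun f => by
        have key : ∀ g : a ⟶ b, maxNorm (-g) ≤ maxNorm g := fun g => by
          simpa using maxNorm_smul_le (-1 : ℂ) g
        have : maxNorm (-f).hom = maxNorm f.hom :=
          le_antisymm (key _) (by
            have := key (-f.hom)
            rw [neg_neg] at this
            exact this)
        exact congrArg _ this }

variable [IsPreCStar A]

theorem norm_def (f : NHom a b) : ‖f‖ = (maxNorm f.hom).toReal := rfl

theorem enorm_def (f : NHom a b) : ‖f‖ₑ = maxNorm f.hom := by
  rw [← ofReal_norm, norm_def, ENNReal.ofReal_toReal (IsPreCStar.maxNorm_lt_top _).ne]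

noncomputable instance : NormedSpace ℂ (NHom a b) where
  norm_smul_le c f := by
    rw [norm_def, norm_def, ← toReal_enorm, ← ENNReal.toReal_mul]
    exact ENNReal.toReal_mono
      (ENNReal.mul_lt_top enorm_lt_top (IsPreCStar.maxNorm_lt_top _)).ne (maxNorm_smul_le _ _)

end NHom

/-- A `C*`-category: a pre-`C*`-category whose morphism spaces are Banach spaces for the
maximal norm. -/
class IsCStar (A : Type u) [Category.{v} A] [CLinStarCategory A] : Prop extends
    IsPreCStar A where
  eq_zero_of_norm : ∀ {a b : A} (f : NHom a b), ‖f‖ = 0 → f = 0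
  complete : ∀ a b : A, CompleteSpace (NHom a b)

/-! ### The functor `Bd^∞` -/

/-- Wide `ℂ`-linear `*`-subcategories. -/
structure StarSub (A : Type u) [Category.{v} A] [CLinStarCategory A] where
  hom : ∀ a b : A, Submodule ℂ (a ⟶ b)
  id_mem : ∀ a : A, 𝟙 a ∈ hom a a
  comp_mem : ∀ {a b c : A} (f : a ⟶ b) (g : b ⟶ c), f ∈ hom a b → g ∈ hom b c → f ≫ g ∈ hom a c
  dag_mem : ∀ {a b : A} (f : a ⟶ b), f ∈ hom a b → dag f ∈ hom b a

/-- The category underlying a wide subcategory. -/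
structure StarSub.Carrier {A : Type u} [Category.{v} A] [CLinStarCategory A]
    (S : StarSub A) : Type u where
  obj : A

namespace StarSub

variable {A : Type u} [Category.{v} A] [CLinStarCategory A]

instance (S : StarSub A) : Category.{v} S.Carrier where
  Hom a b := S.hom a.obj b.obj
  id a := ⟨𝟙 a.obj, S.id_mem _⟩
  comp f g := ⟨f.1 ≫ g.1, S.comp_mem _ _ f.2 g.2⟩

instance (S : StarSub A) : CLinStarCategory S.Carrier where
  homGroup a b := inferInstanceAs (AddCommGroup (S.hom a.obj b.obj))
  add_comp _ _ _ _ _ _ := Subtype.ext (Preadditive.add_comp _ _ _ _ _ _)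
  comp_add _ _ _ _ _ _ := Subtype.ext (Preadditive.comp_add _ _ _ _ _ _)
  homModule a b := inferInstanceAs (Module ℂ (S.hom a.obj b.obj))
  smul_comp _ _ _ _ _ _ := Subtype.ext (Linear.smul_comp _ _ _ _ _ _)
  comp_smul _ _ _ _ _ _ := Subtype.ext (Linear.comp_smul _ _ _ _ _ _)
  dag f := ⟨dag f.1, S.dag_mem _ f.2⟩
  dag_dag _ := Subtype.ext (StarCategory.dag_dag _)
  dag_id _ := Subtype.ext (StarCategory.dag_id _)
  dag_comp _ _ := Subtype.ext (StarCategory.dag_comp _ _)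
  dag_add _ _ := Subtype.ext (CLinStarCategory.dag_add _ _)
  dag_smul _ _ := Subtype.ext (CLinStarCategory.dag_smul _ _)

/-- The marking induced on a wide subcategory. -/
def marking (S : StarSub A) (M : Marking A) : Marking S.Carrier where
  marked f := M.marked f.1
  unitary _ hf := ⟨Subtype.ext (M.unitary _ hf).1, Subtype.ext (M.unitary _ hf).2⟩
  id _ := M.id _
  comp _ _ hf hg := M.comp _ _ hf hg
  star _ hf := M.star _ hf

/-- The whole category, as a wide subcategory. -/
def whole (A : Type u) [Category.{v} A] [CLinStarCategory A] : StarSub A where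
  hom _ _ := ⊤
  id_mem _ := trivial
  comp_mem _ _ _ _ := trivial
  dag_mem _ _ := trivial

/-- A morphism of a wide subcategory. -/
def mkHom (S : StarSub A) {a b : A} (f : a ⟶ b) (h : f ∈ S.hom a b) :
    (⟨a⟩ : S.Carrier) ⟶ ⟨b⟩ :=
  (⟨f, h⟩ : S.hom a b)

/-- The morphism `f` belongs to `S` and has finite maximal norm in the category `S`. -/
def IsBounded (S : StarSub A) {a b : A} (f : a ⟶ b) : Prop :=
  ∃ h : f ∈ S.hom a b, maxNorm (S.mkHom f h) < ⊤

/-- The subcategory `Bd(S)` of the morphisms of `S` with finite maximal norm, where the maximal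
norm is the one of the `ℂ`-linear `*`-category `S`. -/
def bd (S : StarSub A) : StarSub A where
  hom a b :=
    { carrier := {f | S.IsBounded f}
      zero_mem' := ⟨Submodule.zero_mem _,
        (maxNorm_zero (⟨a⟩ : S.Carrier) ⟨b⟩).trans_lt ENNReal.zero_lt_top⟩
      add_mem' := fun {f g} hf hg => by
        obtain ⟨hf, hf'⟩ := hf
        obtain ⟨hg, hg'⟩ := hg
        exact ⟨Submodule.add_mem _ hf hg,
          (maxNorm_add_le (S.mkHom f hf) (S.mkHom g hg)).trans_lt
            (ENNReal.add_lt_top.2 ⟨hf', hg'⟩)⟩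
      smul_mem' := fun c f hf => by
        obtain ⟨hf, hf'⟩ := hf
        exact ⟨Submodule.smul_mem _ c hf, (maxNorm_smul_le c (S.mkHom f hf)).trans_lt
          (ENNReal.mul_lt_top enorm_lt_top hf')⟩ }
  id_mem a := ⟨S.id_mem a,
    (maxNorm_unitary_le (IsUnitary.id (⟨a⟩ : S.Carrier))).trans_lt ENNReal.one_lt_top⟩
  comp_mem f g hf hg := by
    obtain ⟨hf, hf'⟩ := hf
    obtain ⟨hg, hg'⟩ := hg
    exact ⟨S.comp_mem f g hf hg, (maxNorm_comp_le (S.mkHom f hf) (S.mkHom g hg)).trans_lt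
      (ENNReal.mul_lt_top hg' hf')⟩
  dag_mem f hf := by
    obtain ⟨hf, hf'⟩ := hf
    exact ⟨S.dag_mem f hf, (maxNorm_dag_le (S.mkHom f hf)).trans_lt hf'⟩

/-- The iterates `Bd^n(A)`. -/
def bdIter (A : Type u) [Category.{v} A] [CLinStarCategory A] : ℕ → StarSub A
  | 0 => whole A
  | n + 1 => (bdIter A n).bd

/-- The intersection `Bd^∞(A)` of the subcategories `Bd^n(A)`. -/
def bdInf (A : Type u) [Category.{v} A] [CLinStarCategory A] : StarSub A where
  hom a b := ⨅ n, (bdIter A n).hom a b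
  id_mem a := (Submodule.mem_iInf _).2 fun n => (bdIter A n).id_mem a
  comp_mem f g hf hg := (Submodule.mem_iInf _).2 fun n =>
    (bdIter A n).comp_mem f g ((Submodule.mem_iInf _).1 hf n) ((Submodule.mem_iInf _).1 hg n)
  dag_mem f hf := (Submodule.mem_iInf _).2 fun n =>
    (bdIter A n).dag_mem f ((Submodule.mem_iInf _).1 hf n)

/-- The restriction of a functor to wide subcategories. -/
def restrict {A' : Type u₁} [Category.{v₁} A'] [CLinStarCategory A'] (F : CLinStarFunctor A A')
    (S : StarSub A) (S' : StarSub A')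
    (h : ∀ {a b : A} (f : a ⟶ b), f ∈ S.hom a b → F.map f ∈ S'.hom (F.obj a) (F.obj b)) :
    CLinStarFunctor S.Carrier S'.Carrier where
  obj a := ⟨F.obj a.obj⟩
  map f := ⟨F.map f.1, h f.1 f.2⟩
  map_id _ := Subtype.ext (F.map_id _)
  map_comp _ _ := Subtype.ext (F.map_comp _ _)
  map_star _ := Subtype.ext (F.map_star _)
  map_add _ _ := Subtype.ext (F.map_add _ _)
  map_smul _ _ := Subtype.ext (F.map_smul _ _)

theorem map_mem_bdIter {A' : Type u} [Category.{v} A'] [CLinStarCategory A']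
    (F : CLinStarFunctor A A') (n : ℕ) : ∀ {a b : A} (f : a ⟶ b), f ∈ (bdIter A n).hom a b →
      F.map f ∈ (bdIter A' n).hom (F.obj a) (F.obj b) := by
  induction n with
  | zero => intro a b f _; exact trivial
  | succ n ih =>
    intro a b f hf
    obtain ⟨hf, hf'⟩ : (bdIter A n).IsBounded f := hf
    exact ⟨ih f hf, (maxNorm_map_le (restrict F (bdIter A n) (bdIter A' n) ih)
      ((bdIter A n).mkHom f hf)).trans_lt hf'⟩

theorem map_mem_bdInf {A' : Type u} [Category.{v} A'] [CLinStarCategory A']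
    (F : CLinStarFunctor A A') {a b : A} (f : a ⟶ b) (hf : f ∈ (bdInf A).hom a b) :
    F.map f ∈ (bdInf A').hom (F.obj a) (F.obj b) :=
  (Submodule.mem_iInf _).2 fun n => map_mem_bdIter F n f ((Submodule.mem_iInf _).1 hf n)

/-- The functor to a wide subcategory containing all morphisms. -/
def lift (S : StarSub A) (h : ∀ {a b : A} (f : a ⟶ b), f ∈ S.hom a b) :
    CLinStarFunctor A S.Carrier where
  obj a := ⟨a⟩
  map f := ⟨f, h f⟩
  map_id _ := rfl
  map_comp _ _ := rfl
  map_star _ := rfl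
  map_add _ _ := rfl
  map_smul _ _ := rfl

theorem mem_bdIter [IsPreCStar A] (n : ℕ) :
    ∀ {a b : A} (f : a ⟶ b), f ∈ (bdIter A n).hom a b := by
  induction n with
  | zero => intro a b f; exact trivial
  | succ n ih =>
    intro a b f
    change (bdIter A n).IsBounded f
    exact ⟨ih f, (maxNorm_map_le (lift (bdIter A n) ih) f).trans_lt
      (IsPreCStar.maxNorm_lt_top f)⟩

theorem mem_bdInf [IsPreCStar A] {a b : A} (f : a ⟶ b) : f ∈ (bdInf A).hom a b :=
  (Submodule.mem_iInf _).2 fun n => mem_bdIter n f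

theorem isPreCStar_bdInf [IsPreCStar A] : IsPreCStar (bdInf A).Carrier where
  maxNorm_lt_top {a b} f := (maxNorm_map_le (lift (bdInf A) mem_bdInf)
    (a := a.obj) (b := b.obj) f.1).trans_lt (IsPreCStar.maxNorm_lt_top f.1)

end StarSub

/-- The functor `Bd^∞`. -/
def MCLinStarCat.bdInf : MCLinStarCat.{v, u} ⥤ MCLinStarCat.{v, u} where
  obj A := ⟨(StarSub.bdInf A.carrier).Carrier, (StarSub.bdInf A.carrier).marking A.marking⟩
  map {A B} F :=
    { StarSub.restrict F.toCLinStarFunctor (StarSub.bdInf A.carrier) (StarSub.bdInf B.carrier)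
        (StarSub.map_mem_bdInf F.toCLinStarFunctor) with
      map_marked := fun f hf => F.map_marked f.1 hf }
  map_id _ := rfl
  map_comp _ _ := rfl

/-- The canonical identification of a pre-`C*`-category `A` with `Bd^∞(A)`. -/
def MCLinStarCat.toBdInf (A : MCLinStarCat.{v, u}) [IsPreCStar A.carrier] :
    A ⟶ MCLinStarCat.bdInf.obj A :=
  ({ StarSub.lift (StarSub.bdInf A.carrier) StarSub.mem_bdInf with
      map_marked := fun _ hf => hf } : MCLinStarCat.Hom A (MCLinStarCat.bdInf.obj A))

/-- The canonical unitary transformation from the constant functor with value `a(1)` to `a`. -/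
def UFun.fromConst {G : Type v} [Group G] {A : Type u} [Category.{v₁} A] [StarCategory A]
    {M : Marking A} (a : UFun (GTilde G) M) :
    (Functor.const (GTilde G)).obj (a.toFunctor.obj ⟨1⟩) ⟶ a.toFunctor where
  app g := a.toFunctor.map (PUnit.unit : (⟨1⟩ : GTilde G) ⟶ g)
  naturality g h φ := by
    rw [← a.toFunctor.map_comp]
    exact Category.id_comp _

theorem UFun.fromConst_comp {G : Type v} [Group G] {A : Type u} [Category.{v₁} A]
    [StarCategory A] {M : Marking A} {a b : UFun (GTilde G) M}
    (f : a.toFunctor ⟶ b.toFunctor) :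
    a.fromConst ≫ f = (Functor.const (GTilde G)).map (f.app ⟨1⟩) ≫ b.fromConst := by
  ext g
  simp [UFun.fromConst]

theorem UFun.isPreCStar (G : Type v) [Group G] {A : Type (max v u)} [Category.{v} A]
    [CLinStarCategory A] (M : Marking A) [IsPreCStar A] : IsPreCStar (UFun (GTilde G) M) where
  maxNorm_lt_top {a b} f := by
    let C : CLinStarFunctor A (UFun (GTilde G) M) :=
      (MCLinStarCat.const (GTilde G) (⟨A, M⟩ : MCLinStarCat.{v, max v u})).toCLinStarFunctor
    let h (a : UFun (GTilde G) M) : C.obj (a.toFunctor.obj ⟨1⟩) ⟶ a := a.fromConst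
    have hu (a : UFun (GTilde G) M) : IsUnitary (h a) :=
      (UFun.marking (GTilde G) M).unitary _ (fun g => a.marked _)
    have hf : h a ≫ f = C.map (NatTrans.app f ⟨1⟩) ≫ h b := UFun.fromConst_comp f
    have e : f = (dag (h a) ≫ C.map (NatTrans.app f ⟨1⟩)) ≫ h b := by
      rw [Category.assoc, ← hf, ← Category.assoc, (hu a).2, Category.id_comp]
    rw [e]
    refine (maxNorm_comp_le _ _).trans_lt (ENNReal.mul_lt_top
      ((maxNorm_unitary_le (hu b)).trans_lt ENNReal.one_lt_top)
      ((maxNorm_comp_le _ _).trans_lt (ENNReal.mul_lt_top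
        ((maxNorm_map_le C _).trans_lt (IsPreCStar.maxNorm_lt_top _))
        ((maxNorm_unitary_le (hu a).star).trans_lt ENNReal.one_lt_top))))


/-! ### The completion of a pre-`C*`-category -/

theorem maxNorm_comp_dag {A : Type u} [Category.{v} A] [CLinStarCategory A] {a b : A}
    (f : a ⟶ b) : maxNorm f ^ 2 ≤ maxNorm (f ≫ dag f) := by
  have h : maxNorm f ≤ maxNorm (f ≫ dag f) ^ (2 : ℝ)⁻¹ := by
    refine maxNorm_le fun B _ ρ => ?_
    rw [ENNReal.le_rpow_inv_iff (by norm_num)]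
    refine le_trans (le_of_eq ?_) (le_maxNorm ρ (f ≫ dag f))
    rw [ρ.map_comp, ρ.map_star, ← ofReal_norm, ← ofReal_norm, CStarRing.norm_star_mul_self,
      ENNReal.ofReal_mul (norm_nonneg _), ENNReal.rpow_two, sq]
  rw [ENNReal.le_rpow_inv_iff (by norm_num), ENNReal.rpow_two] at h
  exact h

open UniformSpace (Completion)

/-- The completion `Compl(A)` has the objects of `A`; its morphism spaces are the (Hausdorff)
completions of those of `A` in the maximal norm. -/
structure CStarCompl (A : Type u) : Type u where
  obj : A

namespace CStarCompl

variable {A : Type u} [Category.{v} A] [CLinStarCategory A] [IsPreCStar A] {a b c d : A}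

noncomputable section

theorem norm_comp_le (f : NHom a b) (g : NHom b c) :
    ‖(⟨f.hom ≫ g.hom⟩ : NHom a c)‖ ≤ ‖f‖ * ‖g‖ := by
  rw [NHom.norm_def, NHom.norm_def, NHom.norm_def, ← ENNReal.toReal_mul, mul_comm]
  exact ENNReal.toReal_mono (ENNReal.mul_lt_top (IsPreCStar.maxNorm_lt_top _)
    (IsPreCStar.maxNorm_lt_top _)).ne (maxNorm_comp_le _ _)

theorem norm_dag_eq (f : NHom a b) : ‖(⟨dag f.hom⟩ : NHom b a)‖ = ‖f‖ :=
  by rw [NHom.norm_def, NHom.norm_def]; exact congrArg ENNReal.toReal (maxNorm_dag f.hom)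

/-- Composition as a bounded bilinear map. -/
def compAux (a b c : A) : NHom a b →L[ℂ] NHom b c →L[ℂ] Completion (NHom a c) :=
  LinearMap.mkContinuous₂
    (LinearMap.mk₂ ℂ (fun f g => ((⟨f.hom ≫ g.hom⟩ : NHom a c) : Completion (NHom a c)))
      (fun f f' g => by
        rw [← Completion.coe_add]; congr 1
        exact congrArg NHom.mk (Preadditive.add_comp _ _ _ _ _ _))
      (fun r f g => by
        rw [← Completion.coe_smul]; congr 1
        exact congrArg NHom.mk (Linear.smul_comp _ _ _ _ _ _))
      (fun f g g' => by
        rw [← Completion.coe_add]; congr 1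
        exact congrArg NHom.mk (Preadditive.comp_add _ _ _ _ _ _))
      (fun r f g => by
        rw [← Completion.coe_smul]; congr 1
        exact congrArg NHom.mk (Linear.comp_smul _ _ _ _ _ _))) 1
    (fun f g => by
      rw [one_mul, LinearMap.mk₂_apply, Completion.norm_coe]
      exact norm_comp_le f g)

/-- The involution as a bounded antilinear map. -/
def dagAux (a b : A) : NHom a b →SL[starRingEnd ℂ] Completion (NHom b a) :=
  LinearMap.mkContinuous
    { toFun := fun f => ((⟨dag f.hom⟩ : NHom b a) : Completion (NHom b a))
      map_add' := fun f g => by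
        rw [← Completion.coe_add]; congr 1
        exact congrArg NHom.mk (CLinStarCategory.dag_add _ _)
      map_smul' := fun r f => by
        rw [← Completion.coe_smul]; congr 1
        exact congrArg NHom.mk (CLinStarCategory.dag_smul _ _) } 1
    (fun f => by
      rw [one_mul]
      change ‖((⟨dag f.hom⟩ : NHom b a) : Completion (NHom b a))‖ ≤ _
      rw [Completion.norm_coe, norm_dag_eq])

/-- Composition in the completion. -/
def compC (a b c : A) : Completion (NHom a b) →L[ℂ] Completion (NHom b c) →L[ℂ]
    Completion (NHom a c) :=
  (((compAux a b c).extend Completion.toComplL).flip.extend Completion.toComplL).flip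

/-- The involution of the completion. -/
def dagC (a b : A) : Completion (NHom a b) →SL[starRingEnd ℂ] Completion (NHom b a) :=
  (dagAux a b).extend (Completion.toComplL (𝕜 := ℂ))

theorem extend_coe {E F : Type*} [SeminormedAddCommGroup E] [NormedSpace ℂ E]
    [AddCommGroup F] [UniformSpace F] [IsUniformAddGroup F] [T0Space F] [Module ℂ F]
    [ContinuousConstSMul ℂ F] [CompleteSpace F] {σ : ℂ →+* ℂ} (f : E →SL[σ] F)
    (x : E) : f.extend (Completion.toComplL (𝕜 := ℂ) (E := E)) (x : Completion E) = f x :=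
  f.extend_eq (e := Completion.toComplL (𝕜 := ℂ) (E := E)) Completion.denseRange_coe
    (Completion.isUniformInducing_coe E) x

theorem compC_coe (f : NHom a b) (g : NHom b c) :
    compC a b c f g = ((⟨f.hom ≫ g.hom⟩ : NHom a c) : Completion (NHom a c)) := by
  rw [compC, ContinuousLinearMap.flip_apply, extend_coe, ContinuousLinearMap.flip_apply,
    extend_coe]
  rfl

theorem dagC_coe (f : NHom a b) :
    dagC a b f = ((⟨dag f.hom⟩ : NHom b a) : Completion (NHom b a)) := by
  rw [dagC, extend_coe]
  rfl

theorem compC_add_left (x x' : Completion (NHom a b)) (y : Completion (NHom b c)) :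
    compC a b c (x + x') y = compC a b c x y + compC a b c x' y := by
  rw [map_add]; rfl

theorem compC_zero_left (y : Completion (NHom b c)) :
    compC a b c (0 : Completion (NHom a b)) y = 0 := by
  rw [map_zero]; rfl

theorem compC_smul_left (r : ℂ) (x : Completion (NHom a b)) (y : Completion (NHom b c)) :
    compC a b c (r • x) y = r • compC a b c x y := by
  rw [map_smul]; rfl

theorem compC_add_right (x : Completion (NHom a b)) (y y' : Completion (NHom b c)) :
    compC a b c x (y + y') = compC a b c x y + compC a b c x y' := map_add _ _ _

theorem compC_smul_right (x : Completion (NHom a b)) (r : ℂ) (y : Completion (NHom b c)) :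
    compC a b c x (r • y) = r • compC a b c x y := map_smul _ _ _

theorem dagC_add (x y : Completion (NHom a b)) :
    dagC a b (x + y) = dagC a b x + dagC a b y := map_add _ _ _

theorem dagC_smul (r : ℂ) (x : Completion (NHom a b)) :
    dagC a b (r • x) = starRingEnd ℂ r • dagC a b x := map_smulₛₗ _ _ _

theorem idC_comp (x : Completion (NHom a b)) : compC a a b (⟨𝟙 a⟩ : NHom a a) x = x := by
  induction x using Completion.induction_on with
  | hp => exact isClosed_eq (by fun_prop) continuous_id
  | ih f => rw [compC_coe, Category.id_comp]

theorem comp_idC (x : Completion (NHom a b)) : compC a b b x (⟨𝟙 b⟩ : NHom b b) = x := by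
  induction x using Completion.induction_on with
  | hp => exact isClosed_eq (by fun_prop) continuous_id
  | ih f => rw [compC_coe, Category.comp_id]

theorem assocC (x : Completion (NHom a b)) (y : Completion (NHom b c))
    (z : Completion (NHom c d)) :
    compC a c d (compC a b c x y) z = compC a b d x (compC b c d y z) := by
  induction x, y, z using Completion.induction_on₃ with
  | hp => exact isClosed_eq (by fun_prop) (by fun_prop)
  | ih f g h => rw [compC_coe, compC_coe, compC_coe, compC_coe, Category.assoc]

theorem dagC_dagC (x : Completion (NHom a b)) : dagC b a (dagC a b x) = x := by
  induction x using Completion.induction_on with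
  | hp => exact isClosed_eq (by fun_prop) continuous_id
  | ih f => rw [dagC_coe, dagC_coe, StarCategory.dag_dag]

theorem dagC_comp (x : Completion (NHom a b)) (y : Completion (NHom b c)) :
    dagC a c (compC a b c x y) = compC c b a (dagC b c y) (dagC a b x) := by
  induction x, y using Completion.induction_on₂ with
  | hp => exact isClosed_eq (by fun_prop) (by fun_prop)
  | ih f g => rw [compC_coe, dagC_coe, dagC_coe, dagC_coe, compC_coe, StarCategory.dag_comp]

theorem norm_compC_le (x : Completion (NHom a b)) (y : Completion (NHom b c)) :
    ‖compC a b c x y‖ ≤ ‖x‖ * ‖y‖ := by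
  induction x, y using Completion.induction_on₂ with
  | hp => exact isClosed_le (by fun_prop) (by fun_prop)
  | ih f g =>
    rw [compC_coe, Completion.norm_coe, Completion.norm_coe, Completion.norm_coe]
    exact norm_comp_le f g

theorem norm_dagC (x : Completion (NHom a b)) : ‖dagC a b x‖ = ‖x‖ := by
  induction x using Completion.induction_on with
  | hp => exact isClosed_eq (by fun_prop) (by fun_prop)
  | ih f => rw [dagC_coe, Completion.norm_coe, Completion.norm_coe, norm_dag_eq]

theorem norm_comp_dagC (x : Completion (NHom a b)) :
    ‖x‖ * ‖x‖ ≤ ‖compC a b a x (dagC a b x)‖ := by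
  induction x using Completion.induction_on with
  | hp => exact isClosed_le (by fun_prop) (by fun_prop)
  | ih f =>
    rw [dagC_coe, compC_coe, Completion.norm_coe, Completion.norm_coe, NHom.norm_def,
      NHom.norm_def, ← ENNReal.toReal_mul, ← sq]
    exact ENNReal.toReal_mono (IsPreCStar.maxNorm_lt_top _).ne (maxNorm_comp_dag f.hom)

instance : Category.{v} (CStarCompl A) where
  Hom a b := Completion (NHom a.obj b.obj)
  id a := ((⟨𝟙 a.obj⟩ : NHom a.obj a.obj) : Completion (NHom a.obj a.obj))
  comp f g := compC _ _ _ f g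
  id_comp f := idC_comp f
  comp_id f := comp_idC f
  assoc f g h := assocC f g h

instance : CLinStarCategory (CStarCompl A) where
  homGroup a b := inferInstanceAs (AddCommGroup (Completion (NHom a.obj b.obj)))
  add_comp a b c f f' g := compC_add_left (a := a.obj) (b := b.obj) (c := c.obj) f f' g
  comp_add a b c f g g' := compC_add_right (a := a.obj) (b := b.obj) (c := c.obj) f g g'
  homModule a b := inferInstanceAs (Module ℂ (Completion (NHom a.obj b.obj)))
  smul_comp a b c r f g := compC_smul_left (a := a.obj) (b := b.obj) (c := c.obj) r f g
  comp_smul a b c f r g := compC_smul_right (a := a.obj) (b := b.obj) (c := c.obj) f r g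
  dag f := dagC _ _ f
  dag_dag f := dagC_dagC f
  dag_id a := by
    change dagC a.obj a.obj ((⟨𝟙 a.obj⟩ : NHom a.obj a.obj) : Completion (NHom a.obj a.obj)) = _
    rw [dagC_coe, StarCategory.dag_id]; rfl
  dag_comp f g := dagC_comp f g
  dag_add {a b} f g := dagC_add (a := a.obj) (b := b.obj) f g
  dag_smul {a b} c f := dagC_smul (a := a.obj) (b := b.obj) c f

/-- The endomorphisms of an object of the completion. -/
def EndC (a : A) : Type v := Completion (NHom a a)

namespace EndC

instance : NormedAddCommGroup (EndC a) := inferInstanceAs (NormedAddCommGroup (Completion _))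
instance : NormedSpace ℂ (EndC a) := inferInstanceAs (NormedSpace ℂ (Completion (NHom a a)))
instance : CompleteSpace (EndC a) := inferInstanceAs (CompleteSpace (Completion _))

instance : NonUnitalNormedRing (EndC a) :=
  { (inferInstance : NormedAddCommGroup (EndC a)) with
    mul := fun x y => compC a a a y x
    left_distrib := fun x y z => compC_add_left (a := a) (b := a) (c := a) y z x
    right_distrib := fun x y z => map_add (compC a a a z) x y
    zero_mul := fun x => map_zero (compC a a a x)
    mul_zero := fun x => compC_zero_left (a := a) (b := a) (c := a) x
    mul_assoc := fun x y z => (assocC (a := a) (b := a) (c := a) (d := a) z y x).symm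
    norm_mul_le := fun x y => (norm_compC_le (a := a) (b := a) (c := a) y x).trans
      (le_of_eq (mul_comm _ _)) }

instance : StarRing (EndC a) where
  star x := dagC a a x
  star_involutive x := dagC_dagC (a := a) (b := a) x
  star_mul x y := dagC_comp (a := a) (b := a) (c := a) y x
  star_add x y := map_add (dagC a a) x y

instance : NonUnitalCStarAlgebra (EndC a) where
  smul_assoc r x y := map_smul (compC a a a y) r x
  smul_comm r x y := (compC_smul_left (a := a) (b := a) (c := a) r y x).symm
  star_smul r x := map_smulₛₗ (dagC a a) r x
  norm_mul_self_le x := norm_comp_dagC (a := a) (b := a) x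

end EndC

theorem norm_rep_le {B : Type w} [NonUnitalCStarAlgebra B] (ρ : CStarRep (CStarCompl A) B)
    {a b : A} (x : Completion (NHom a b)) :
    ‖ρ.toFun (a := ⟨a⟩) (b := ⟨b⟩) x‖ ≤ ‖x‖ := by
  let φ : EndC a →⋆ₙₐ[ℂ] B :=
    { toFun := fun y => ρ.toFun (a := ⟨a⟩) (b := ⟨a⟩) y
      map_smul' := fun c y => map_smul (ρ.toFun (a := ⟨a⟩) (b := ⟨a⟩)) c y
      map_zero' := map_zero (ρ.toFun (a := ⟨a⟩) (b := ⟨a⟩))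
      map_add' := fun y z => map_add (ρ.toFun (a := ⟨a⟩) (b := ⟨a⟩)) y z
      map_mul' := fun y z => ρ.map_comp (a := ⟨a⟩) (b := ⟨a⟩) (c := ⟨a⟩) z y
      map_star' := fun y => ρ.map_star (a := ⟨a⟩) (b := ⟨a⟩) y }
  let y : EndC a := compC a b a x (dagC a b x)
  have h1 : ‖φ y‖ ≤ ‖y‖ := NonUnitalStarAlgHom.norm_apply_le φ y
  have h2 : φ y = star (ρ.toFun (a := ⟨a⟩) (b := ⟨b⟩) x) * ρ.toFun (a := ⟨a⟩) (b := ⟨b⟩) x := by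
    rw [← ρ.map_star, ← ρ.map_comp]; rfl
  have h3 : ‖y‖ ≤ ‖x‖ * ‖dagC a b x‖ := norm_compC_le x (dagC a b x)
  rw [norm_dagC] at h3
  rw [h2, CStarRing.norm_star_mul_self] at h1
  exact (mul_self_le_mul_self_iff (norm_nonneg _) (norm_nonneg _)).2 (h1.trans h3)

/-- The bounded linear map underlying a representation. -/
def repAux {B : Type (max u v)} [NonUnitalCStarAlgebra B] (ρ : CStarRep A B) (a b : A) :
    NHom a b →L[ℂ] B :=
  LinearMap.mkContinuous
    { toFun := fun f => ρ.toFun f.hom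
      map_add' := fun f g => map_add ρ.toFun f.hom g.hom
      map_smul' := fun c f => map_smul ρ.toFun c f.hom } 1
    (fun f => by
      rw [one_mul, NHom.norm_def]
      change ‖ρ.toFun f.hom‖ ≤ _
      rw [← toReal_enorm]
      exact ENNReal.toReal_mono (IsPreCStar.maxNorm_lt_top _).ne (le_maxNorm ρ f.hom))

/-- The extension of a representation to the completion. -/
def repExtend {B : Type (max u v)} [NonUnitalCStarAlgebra B] (ρ : CStarRep A B) :
    CStarRep (CStarCompl A) B where
  toFun {a b} := ((repAux ρ a.obj b.obj).extend (Completion.toComplL (𝕜 := ℂ)) : _ →L[ℂ] B)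
  map_comp {a b c} f g := by
    change (repAux ρ a.obj c.obj).extend (Completion.toComplL (𝕜 := ℂ)) (compC _ _ _ f g) =
      (repAux ρ b.obj c.obj).extend (Completion.toComplL (𝕜 := ℂ)) g *
      (repAux ρ a.obj b.obj).extend (Completion.toComplL (𝕜 := ℂ)) f
    induction f, g using Completion.induction_on₂ with
    | hp => exact isClosed_eq (by fun_prop) (by fun_prop)
    | ih f g => rw [compC_coe, extend_coe, extend_coe, extend_coe]; exact ρ.map_comp _ _
  map_star {a b} f := by
    change (repAux ρ b.obj a.obj).extend (Completion.toComplL (𝕜 := ℂ)) (dagC _ _ f) =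
      star ((repAux ρ a.obj b.obj).extend (Completion.toComplL (𝕜 := ℂ)) f)
    induction f using Completion.induction_on with
    | hp => exact isClosed_eq (by fun_prop) (by fun_prop)
    | ih f => rw [dagC_coe, extend_coe, extend_coe]; exact ρ.map_star _

instance : IsPreCStar (CStarCompl A) where
  maxNorm_lt_top {a b} f := by
    let x : Completion (NHom a.obj b.obj) := f
    have h : maxNorm f ≤ ENNReal.ofReal ‖x‖ :=
      maxNorm_le fun B _ ρ => by
        rw [← ofReal_norm]; exact ENNReal.ofReal_le_ofReal (norm_rep_le ρ x)
    exact h.trans_lt ENNReal.ofReal_lt_top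

/-- The identification of the completed morphism spaces with the morphism spaces of the
completion, seminormed by the maximal norm. -/
def toNHom (a b : A) : Completion (NHom a b) →L[ℂ] NHom (⟨a⟩ : CStarCompl A) ⟨b⟩ :=
  LinearMap.mkContinuous (E := Completion (NHom a b)) (F := NHom (⟨a⟩ : CStarCompl A) ⟨b⟩)
    (σ := RingHom.id ℂ)
    { toFun := fun x => ⟨x⟩
      map_add' := fun _ _ => rfl
      map_smul' := fun _ _ => rfl } 1
    (fun x => by
      rw [one_mul, NHom.norm_def]
      refine ENNReal.toReal_le_of_le_ofReal (norm_nonneg _) (maxNorm_le fun B _ ρ => ?_)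
      rw [← ofReal_norm]
      exact ENNReal.ofReal_le_ofReal (norm_rep_le ρ x))

theorem norm_toNHom (x : Completion (NHom a b)) : ‖toNHom a b x‖ = ‖x‖ := by
  induction x using Completion.induction_on with
  | hp => exact isClosed_eq (by fun_prop) (by fun_prop)
  | ih f =>
    refine le_antisymm ?_ ?_
    · have := (toNHom a b).le_of_opNorm_le
        (LinearMap.mkContinuous_norm_le _ zero_le_one _) (f : Completion (NHom a b))
      rwa [one_mul] at this
    · rw [Completion.norm_coe, NHom.norm_def, NHom.norm_def]
      refine ENNReal.toReal_mono (IsPreCStar.maxNorm_lt_top _).ne (maxNorm_le fun B _ ρ => ?_)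
      have h := le_maxNorm (repExtend ρ) (a := ⟨a⟩) (b := ⟨b⟩) (f : Completion (NHom a b))
      have e : (repExtend ρ).toFun (a := ⟨a⟩) (b := ⟨b⟩) (f : Completion (NHom a b)) =
          ρ.toFun f.hom := extend_coe (repAux ρ a b) f
      rw [e] at h
      exact h

instance : IsCStar (CStarCompl A) where
  eq_zero_of_norm {a b} f hf := by
    let x : Completion (NHom a.obj b.obj) := f.hom
    have h : x = 0 := norm_eq_zero.1 ((norm_toNHom x).symm.trans hf)
    exact congrArg NHom.mk h
  complete a b := by
    have hi : Isometry (toNHom a.obj b.obj) :=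
      AddMonoidHomClass.isometry_of_norm _ norm_toNHom
    have hs : Function.Surjective (toNHom a.obj b.obj) := fun y => ⟨y.hom, rfl⟩
    exact (hi.isUniformInducing.completeSpace_congr hs).1 inferInstance

/-- The marked morphisms of the completion are the images of the marked morphisms. -/
def marking (M : Marking A) : Marking (CStarCompl A) where
  marked {a b} x := ∃ f : a.obj ⟶ b.obj, M.marked f ∧
    x = ((⟨f⟩ : NHom a.obj b.obj) : Completion (NHom a.obj b.obj))
  unitary {a b} x hx := by
    obtain ⟨f, hf, rfl⟩ := hx
    have hu := M.unitary f hf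
    constructor
    · change compC a.obj b.obj a.obj _ (dagC _ _ _) = _
      rw [dagC_coe, compC_coe, hu.1]; rfl
    · change compC b.obj a.obj b.obj (dagC _ _ _) _ = _
      rw [dagC_coe, compC_coe, hu.2]; rfl
  id a := ⟨𝟙 a.obj, M.id _, rfl⟩
  comp {a b c} x y hx hy := by
    obtain ⟨f, hf, rfl⟩ := hx
    obtain ⟨g, hg, rfl⟩ := hy
    exact ⟨f ≫ g, M.comp _ _ hf hg, compC_coe (a := a.obj) (b := b.obj) (c := c.obj) _ _⟩
  star {a b} x hx := by
    obtain ⟨f, hf, rfl⟩ := hx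
    exact ⟨dag f, M.star _ hf, dagC_coe (a := a.obj) (b := b.obj) _⟩

variable {A' : Type u} [Category.{v} A'] [CLinStarCategory A'] [IsPreCStar A']

/-- The bounded linear map underlying the action of a functor on morphisms. -/
def mapAux (F : CLinStarFunctor A A') (a b : A) :
    NHom a b →L[ℂ] Completion (NHom (F.obj a) (F.obj b)) :=
  LinearMap.mkContinuous
    { toFun := fun f => ((⟨F.map f.hom⟩ : NHom (F.obj a) (F.obj b)) : Completion (NHom (F.obj a) (F.obj b)))
      map_add' := fun f g => by
        rw [← Completion.coe_add]; congr 1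
        exact congrArg NHom.mk (F.map_add _ _)
      map_smul' := fun c f => by
        rw [RingHom.id_apply, ← Completion.coe_smul]; congr 1
        exact congrArg NHom.mk (F.map_smul _ _) } 1
    (fun f => by
      rw [one_mul]
      change ‖((⟨F.map f.hom⟩ : NHom (F.obj a) (F.obj b)) : Completion (NHom (F.obj a) (F.obj b)))‖ ≤ _
      rw [Completion.norm_coe]
      exact ENNReal.toReal_mono (IsPreCStar.maxNorm_lt_top _).ne (maxNorm_map_le F f.hom))

/-- The action of a functor on the morphisms of the completion, by continuous extension. -/
def mapC (F : CLinStarFunctor A A') (a b : A) :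
    Completion (NHom a b) →L[ℂ] Completion (NHom (F.obj a) (F.obj b)) :=
  (mapAux F a b).extend Completion.toComplL

theorem mapC_coe (F : CLinStarFunctor A A') (f : NHom a b) :
    mapC F a b f = ((⟨F.map f.hom⟩ : NHom (F.obj a) (F.obj b)) : Completion (NHom (F.obj a) (F.obj b))) := by
  rw [mapC, extend_coe]
  rfl

/-- The completion of a functor. -/
def map (F : CLinStarFunctor A A') : CLinStarFunctor (CStarCompl A) (CStarCompl A') where
  obj a := ⟨F.obj a.obj⟩
  map {a b} x := mapC F a.obj b.obj x
  map_id a := (mapC_coe F _).trans (by rw [F.map_id]; rfl)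
  map_comp {a b c} x y := by
    change mapC F _ _ (compC _ _ _ x y) = compC _ _ _ (mapC F _ _ x) (mapC F _ _ y)
    induction x, y using Completion.induction_on₂ with
    | hp => exact isClosed_eq (by fun_prop) (by fun_prop)
    | ih f g => rw [compC_coe, mapC_coe, mapC_coe, mapC_coe, compC_coe, F.map_comp]
  map_star {a b} x := by
    change mapC F _ _ (dagC _ _ x) = dagC _ _ (mapC F _ _ x)
    induction x using Completion.induction_on with
    | hp => exact isClosed_eq (by fun_prop) (by fun_prop)
    | ih f => rw [dagC_coe, mapC_coe, mapC_coe, dagC_coe, F.map_star]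
  map_add {a b} x y := map_add (mapC F a.obj b.obj) x y
  map_smul {a b} c x := map_smul (mapC F a.obj b.obj) c x

/-- The functor from a pre-`C*`-category to its completion. -/
def ofPre (A : Type u) [Category.{v} A] [CLinStarCategory A] [IsPreCStar A] :
    CLinStarFunctor A (CStarCompl A) where
  obj a := ⟨a⟩
  map {a b} f := ((⟨f⟩ : NHom a b) : Completion (NHom a b))
  map_id _ := rfl
  map_comp {a b c} f g := (compC_coe (a := a) (b := b) (c := c) ⟨f⟩ ⟨g⟩).symm
  map_star {a b} f := (dagC_coe (a := a) (b := b) ⟨f⟩).symm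
  map_add {a b} f g := Completion.coe_add (⟨f⟩ : NHom a b) ⟨g⟩
  map_smul {a b} c f := Completion.coe_smul c (⟨f⟩ : NHom a b)

end

end CStarCompl


/-! ### The categories of (marked) pre-`C*`-categories and `C*`-categories -/

/-- Pre-`C*`-categories, as a full subcategory of `ℂ`-linear `*`-categories. -/
abbrev PreCStarCat :=
  ObjectProperty.FullSubcategory (fun A : CLinStarCat.{v, u} => IsPreCStar A.carrier)

/-- `C*`-categories, as a full subcategory of `ℂ`-linear `*`-categories. -/
abbrev CStarCat :=
  ObjectProperty.FullSubcategory (fun A : CLinStarCat.{v, u} => IsCStar A.carrier)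

/-- Marked pre-`C*`-categories, as a full subcategory of marked `ℂ`-linear `*`-categories. -/
abbrev MPreCStarCat :=
  ObjectProperty.FullSubcategory (fun A : MCLinStarCat.{v, u} => IsPreCStar A.carrier)

/-- Marked `C*`-categories, as a full subcategory of marked `ℂ`-linear `*`-categories. -/
abbrev MCStarCat :=
  ObjectProperty.FullSubcategory (fun A : MCLinStarCat.{v, u} => IsCStar A.carrier)

instance (A : PreCStarCat.{v, u}) : IsPreCStar A.obj.carrier := A.property
instance (A : CStarCat.{v, u}) : IsCStar A.obj.carrier := A.property
instance (A : MPreCStarCat.{v, u}) : IsPreCStar A.obj.carrier := A.property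
instance (A : MCStarCat.{v, u}) : IsCStar A.obj.carrier := A.property

/-- Mark all unitaries. -/
def PreCStarCat.ma : PreCStarCat.{v, u} ⥤ MPreCStarCat.{v, u} :=
  ObjectProperty.lift _ (ObjectProperty.ι _ ⋙ CLinStarCat.ma) (fun A => A.property)

/-- Forget the marking. -/
def MPreCStarCat.forget : MPreCStarCat.{v, u} ⥤ PreCStarCat.{v, u} :=
  ObjectProperty.lift _ (ObjectProperty.ι _ ⋙ MCLinStarCat.forget) (fun A => A.property)

/-- Mark all unitaries. -/
def CStarCat.ma : CStarCat.{v, u} ⥤ MCStarCat.{v, u} :=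
  ObjectProperty.lift _ (ObjectProperty.ι _ ⋙ CLinStarCat.ma) (fun A => A.property)

/-- Forget the marking. -/
def MCStarCat.forget : MCStarCat.{v, u} ⥤ CStarCat.{v, u} :=
  ObjectProperty.lift _ (ObjectProperty.ι _ ⋙ MCLinStarCat.forget) (fun A => A.property)

/-- The inclusion of marked `C*`-categories into marked pre-`C*`-categories. -/
def MCStarCat.toMPreCStarCat : MCStarCat.{v, u} ⥤ MPreCStarCat.{v, u} :=
  ObjectProperty.lift _ (ObjectProperty.ι _) (fun A => A.property.toIsPreCStar)

/-- The completion functor. -/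
noncomputable def MPreCStarCat.compl : MPreCStarCat.{v, u} ⥤ MCStarCat.{v, u} where
  obj A := ⟨⟨CStarCompl A.obj.carrier, CStarCompl.marking A.obj.marking⟩,
    (inferInstance : IsCStar (CStarCompl A.obj.carrier))⟩
  map {A B} F := ObjectProperty.homMk
    ({ CStarCompl.map F.hom.toCLinStarFunctor with
      map_marked := fun {a b} x hx => by
        obtain ⟨f, hf, rfl⟩ := hx
        exact ⟨F.hom.map f, F.hom.map_marked f hf,
          CStarCompl.mapC_coe F.hom.toCLinStarFunctor (⟨f⟩ : NHom a.obj b.obj)⟩ } :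
      MCLinStarCat.Hom _ _)
  map_id A := by
    refine ObjectProperty.hom_ext _ (MCLinStarCat.hom_ext
      (CategoryTheory.Functor.hext (fun _ => rfl) (fun a b x => heq_of_eq ?_)))
    let K : CLinStarFunctor A.obj.carrier A.obj.carrier :=
      (𝟙 A : A ⟶ A).hom.toCLinStarFunctor
    have key : ∀ y : Completion (NHom a.obj b.obj), CStarCompl.mapC K a.obj b.obj y = y := by
      intro y
      induction y using Completion.induction_on with
      | hp => exact isClosed_eq (ContinuousLinearMap.continuous _) continuous_id
      | ih f => exact CStarCompl.mapC_coe K f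
    exact key x
  map_comp {A B C} F H := by
    refine ObjectProperty.hom_ext _ (MCLinStarCat.hom_ext
      (CategoryTheory.Functor.hext (fun _ => rfl) (fun a b x => heq_of_eq ?_)))
    let K : CLinStarFunctor A.obj.carrier C.obj.carrier := (F ≫ H).hom.toCLinStarFunctor
    let F' := F.hom.toCLinStarFunctor
    let H' := H.hom.toCLinStarFunctor
    have key : ∀ y : Completion (NHom a.obj b.obj), CStarCompl.mapC K a.obj b.obj y =
        CStarCompl.mapC H' (F'.obj a.obj) (F'.obj b.obj) (CStarCompl.mapC F' a.obj b.obj y) := by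
      intro y
      induction y using Completion.induction_on with
      | hp =>
        exact isClosed_eq (CStarCompl.mapC K a.obj b.obj).continuous
          ((CStarCompl.mapC H' (F'.obj a.obj) (F'.obj b.obj)).continuous.comp
            (CStarCompl.mapC F' a.obj b.obj).continuous)
      | ih f => rw [CStarCompl.mapC_coe, CStarCompl.mapC_coe, CStarCompl.mapC_coe]; rfl
    exact key x

/-- The canonical transformation from a marked `C*`-category to its completion. -/
noncomputable def MCStarCat.toCompl :
    𝟭 MCStarCat.{v, u} ⟶ MCStarCat.toMPreCStarCat ⋙ MPreCStarCat.compl where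
  app A := ObjectProperty.homMk
    ({ CStarCompl.ofPre A.obj.carrier with
      map_marked := fun f hf => by exact ⟨f, hf, rfl⟩ } :
      MCLinStarCat.Hom A.obj ⟨CStarCompl A.obj.carrier, CStarCompl.marking A.obj.marking⟩)
  naturality A B F := by
    refine ObjectProperty.hom_ext _ (MCLinStarCat.hom_ext
      (CategoryTheory.Functor.hext (fun _ => rfl) (fun a b f => heq_of_eq ?_)))
    exact (CStarCompl.mapC_coe F.hom.toCLinStarFunctor (⟨f⟩ : NHom a b)).symm

/-- `Fun^bd = Bd^∞(Fun^u)` of the contractible groupoid, for marked pre-`C*`-categories. -/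
def MPreCStarCat.funTilde (G : Type v) [Group G] : GFunctor G MPreCStarCat.{v, max v u} where
  act :=
    { obj := fun i => ObjectProperty.lift _
        (ObjectProperty.ι _ ⋙ (MCLinStarCat.funTilde.{v, u} G).act.obj i ⋙ MCLinStarCat.bdInf)
        (fun A => by
          have := UFun.isPreCStar.{v, u} G A.obj.marking
          exact StarSub.isPreCStar_bdInf (A := UFun (GTilde G) A.obj.marking))
      map := fun g =>
        { app := fun A => ObjectProperty.homMk
            (MCLinStarCat.bdInf.map (((MCLinStarCat.funTilde.{v, u} G).act.map g).app A.obj))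
          naturality := fun A B F => ObjectProperty.hom_ext _ (by
            have h := ((MCLinStarCat.funTilde.{v, u} G).act.map g).naturality F.hom
            exact (MCLinStarCat.bdInf.map_comp _ _).symm.trans
              ((congrArg MCLinStarCat.bdInf.map h).trans (MCLinStarCat.bdInf.map_comp _ _))) }
      map_id := fun i => NatTrans.ext (funext fun A => ObjectProperty.hom_ext _ (by
        exact congrArg (fun α => MCLinStarCat.bdInf.map (NatTrans.app α A.obj))
          ((MCLinStarCat.funTilde.{v, u} G).act.map_id i)))
      map_comp := fun g h => NatTrans.ext (funext fun A => ObjectProperty.hom_ext _ (by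
        change MCLinStarCat.bdInf.map
          (((MCLinStarCat.funTilde.{v, u} G).act.map (g ≫ h)).app A.obj) = _
        rw [Functor.map_comp]
        rfl)) }
  unit :=
    { app := fun i =>
        { app := fun A => ObjectProperty.homMk (MCLinStarCat.toBdInf A.obj ≫
            MCLinStarCat.bdInf.map (((MCLinStarCat.funTilde.{v, u} G).unit.app i).app A.obj))
          naturality := fun A B F => ObjectProperty.hom_ext _ (by
            have h := ((MCLinStarCat.funTilde.{v, u} G).unit.app i).naturality F.hom
            have h' := congrArg MCLinStarCat.bdInf.map h
            exact congrArg (fun k => MCLinStarCat.toBdInf A.obj ≫ k) h') }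
      naturality := fun i j g => NatTrans.ext (funext fun A => ObjectProperty.hom_ext _ (by
        have h := congrArg (fun α => MCLinStarCat.toBdInf A.obj ≫
          MCLinStarCat.bdInf.map (NatTrans.app α A.obj))
          ((MCLinStarCat.funTilde.{v, u} G).unit.naturality g)
        exact h)) }

/-- `Fun^bd` of the contractible groupoid, for pre-`C*`-categories. -/
def PreCStarCat.funTilde (G : Type v) [Group G] : GFunctor G PreCStarCat.{v, max v u} :=
  (MPreCStarCat.funTilde.{v, u} G).conj PreCStarCat.ma MPreCStarCat.forget
    { app := fun A => 𝟙 A }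

/-- `Fun^{C*} = Compl(Fun^bd)` of the contractible groupoid, for marked `C*`-categories. -/
noncomputable def MCStarCat.funTilde (G : Type v) [Group G] :
    GFunctor G MCStarCat.{v, max v u} :=
  (MPreCStarCat.funTilde.{v, u} G).conj MCStarCat.toMPreCStarCat MPreCStarCat.compl
    MCStarCat.toCompl

/-- `Fun^{C*}` of the contractible groupoid, for `C*`-categories. -/
noncomputable def CStarCat.funTilde (G : Type v) [Group G] : GFunctor G CStarCat.{v, max v u} :=
  (MCStarCat.funTilde.{v, u} G).conj CStarCat.ma MCStarCat.forget { app := fun A => 𝟙 A }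

/-! ### Weak equivalences, cofibrations and fibrations -/

/-- The functors `F` and `H` are isomorphic by a transformation with marked components. -/
def MarkedIsomorphic {A B : MStarCat.{v, u}} (F H : A ⟶ B) : Prop :=
  ∃ e : F.toFunctor ≅ H.toFunctor, ∀ a : A.carrier, B.marking.marked (e.hom.app a)

section Injective

variable {C : Type u₁} [Category.{v₁} C] (V : C ⥤ MStarCat.{v, u})

/-- The weak equivalences of a category `C` with a functor `V` to marked `*`-categories: the
morphisms which have an inverse in `C` up to marked isomorphism. In the unmarked cases `V` marks
all unitaries, so that these are the unitary equivalences. -/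
def markedEquivalences : MorphismProperty C := fun A B f =>
  ∃ g : B ⟶ A, MarkedIsomorphic (V.map (g ≫ f)) (V.map (𝟙 B)) ∧
    MarkedIsomorphic (V.map (f ≫ g)) (V.map (𝟙 A))

/-- The cofibrations: the morphisms which are injective on objects. -/
def injectiveOnObjects : MorphismProperty C := fun _ _ f => Function.Injective (V.map f).obj

/-- The weak equivalences of the injective model structure on `Fun(I, C)`. -/
def injectiveWeakEquivalences (I : Type u₂) [Category.{v₂} I] : MorphismProperty (I ⥤ C) :=
  (markedEquivalences V).functorCategory I

/-- The cofibrations of the injective model structure on `Fun(I, C)`. -/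
def injectiveCofibrations (I : Type u₂) [Category.{v₂} I] : MorphismProperty (I ⥤ C) :=
  (injectiveOnObjects V).functorCategory I

/-- The fibrations of the injective model structure on `Fun(I, C)`: the morphisms with the right
lifting property with respect to the trivial cofibrations. -/
def injectiveFibrations (I : Type u₂) [Category.{v₂} I] : MorphismProperty (I ⥤ C) :=
  (injectiveWeakEquivalences V I ⊓ injectiveCofibrations V I).rlp

/-- Fibrant objects: the morphism to a terminal object is a fibration. -/
def IsInjectivelyFibrant {I : Type u₂} [Category.{v₂} I] (X : I ⥤ C) : Prop :=
  ∃ (T : I ⥤ C) (hT : Limits.IsTerminal T), injectiveFibrations V I (hT.from X)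

/-- A fibrant replacement functor: an endofunctor with fibrant values and a natural weak
equivalence from the identity. -/
structure IsInjectiveFibrantReplacement {I : Type u₂} [Category.{v₂} I]
    (R : (I ⥤ C) ⥤ (I ⥤ C)) (r : 𝟭 (I ⥤ C) ⟶ R) : Prop where
  weakEquivalence : ∀ X : I ⥤ C, injectiveWeakEquivalences V I (r.app X)
  fibrant : ∀ X : I ⥤ C, IsInjectivelyFibrant V (R.obj X)

end Injective

/-! Everything is deduced from the case of marked `*`-categories. Since the contractible groupoid
has exactly one morphism between any two objects, a morphism `Y ⟶ uFun G Z` amounts to a family of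
morphisms `F x : Y ⟶ Z`, one for each `x` in `G`, with marked transformations `t x y : F x ⟶ F y`
satisfying the cocycle identities (`toUFun`, `uFun_hom_ext`). It is equivariant when `g` followed by
`F x` is `F (g⁻¹ * x)` followed by `g`, and similarly for the transformations.

The morphism `r` is a weak equivalence because evaluation at `1` inverts it: one composite is the
identity, and the other is joined to the identity by the values of a functor on the morphisms from
`1`, which are marked (`markedEquivalences_const`). This inverse need not be equivariant, since weak
equivalences are objectwise.

For fibrancy, let `i : C ⟶ D` be an equivariant trivial cofibration and `Φ` an equivariant morphism
from `C` to `Fun^u`. Without the action, `i` has a strict retraction `p` (`exists_section`), in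
general not equivariant. The remedy is to use a different conjugate of `p` at each `x`, namely `F x
(d) = Φ (x · p (x⁻¹ · d)) (x)`. This family restricts to `Φ` along `i` and satisfies the
equivariance condition for any choice of `p`. The transformations of `Φ` extend uniquely along `i`,
as precomposition with an equivalence is fully faithful; uniqueness yields the cocycle identities
and the equivariance. Markedness can be tested after restriction along `i`. This is
`exists_lift_funTilde`.

The other cases are transferred along functors `V` to marked `*`-categories. A `GFunctor.Comparison`
identifies the replacement with `Fun^u` along `V`, and `LiftsMarkedEquivalences` brings inverses and
extensions back. Linearity comes for free: inverses of linear equivalences, and extensions of linear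
functors along them, are linear. In the unmarked cases all unitaries are marked, which is fully
faithful, and `Fun^u` again has all unitaries marked. In the analytic cases, a transformation
between functors on the contractible groupoid is its component at `1` conjugated by unitaries, so it
has the same maximal norm as that component. Hence `Fun^u` is already a pre-`C*`-category or a
`C*`-category, and neither `Bd^∞` nor the completion changes it up to isomorphism. -/

/-! ### Unitary and marked morphisms -/

theorem StarFunctor.map_isUnitary {A : Type u₁} [Category.{v₁} A] [StarCategory A]
    {B : Type u₂} [Category.{v₂} B] [StarCategory B] (F : StarFunctor A B) {a b : A} {f : a ⟶ b}
    (h : IsUnitary f) : IsUnitary (F.map f) :=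
  ⟨by rw [← F.map_star, ← F.map_comp, h.1, F.map_id],
    by rw [← F.map_star, ← F.map_comp, h.2, F.map_id]⟩

theorem CategoryTheory.Functor.map_heq_cancel {A : Type u₁} [Category.{v₁} A] {B : Type u₂}
    [Category.{v₂} B] (F : A ⥤ B) [F.Faithful] {a a' b b' : A} (ha : a = a') (hb : b = b')
    {f : a ⟶ b} {f' : a' ⟶ b'} (h : HEq (F.map f) (F.map f')) : HEq f f' := by
  subst ha hb
  exact heq_of_eq (F.map_injective (eq_of_heq h))

theorem Marking.marked_of_heq {A : Type u} [Category.{v} A] [StarCategory A] (M : Marking A)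
    {a a' b b' : A} (ha : a = a') (hb : b = b') {f : a ⟶ b} {f' : a' ⟶ b'} (h : HEq f f')
    (hf : M.marked f) : M.marked f' := by
  subst ha hb
  rwa [← eq_of_heq h]

theorem IsUnitary.inv_eq {A : Type u} [Category.{v} A] [StarCategory A] {a b : A} {f : a ⟶ b}
    [IsIso f] (hf : IsUnitary f) : inv f = dag f := IsIso.inv_eq_of_hom_inv_id hf.1

/-- A marked isomorphism is unitary, so its inverse is its adjoint, and markings are closed under
the involution. -/
theorem Marking.marked_inv {A : Type u} [Category.{v} A] [StarCategory A] (M : Marking A)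
    {a b : A} (e : a ≅ b) (h : M.marked e.hom) : M.marked e.inv := by
  have := (M.unitary _ h).inv_eq
  rw [IsIso.Iso.inv_hom] at this
  rw [this]
  exact M.star _ h

/-! ### Marked isomorphisms of functors -/

namespace MStarCat

variable {A B C D : MStarCat.{v, u}}

theorem markedIsomorphic_of_eq {F H : A ⟶ B} (h : F = H) : MarkedIsomorphic F H := by
  subst h
  exact ⟨Iso.refl _, fun a => B.marking.id _⟩

theorem _root_.MarkedIsomorphic.whisker {F H : B ⟶ C} (h : MarkedIsomorphic F H) (K : A ⟶ B)
    (L : C ⟶ D) : MarkedIsomorphic (K ≫ F ≫ L) (K ≫ H ≫ L) := by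
  obtain ⟨e, he⟩ := h
  exact ⟨Functor.isoWhiskerLeft K.toFunctor (Functor.isoWhiskerRight e L.toFunctor),
    fun a => L.map_marked _ (he _)⟩

/-- The composition of a marked equivalence with an isomorphism is a marked equivalence. -/
theorem markedEquivalences_comp_iso {F : A ⟶ B} (hF : markedEquivalences (𝟭 MStarCat.{v, u}) F)
    (e : B ≅ C) : markedEquivalences (𝟭 MStarCat.{v, u}) (F ≫ e.hom) := by
  obtain ⟨g, h₁, h₂⟩ := hF
  refine ⟨e.inv ≫ g, ?_, ?_⟩
  · have h := h₁.whisker e.inv e.hom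
    have e₁ : e.inv ≫ (𝟭 MStarCat.{v, u}).map (𝟙 B) ≫ e.hom = 𝟙 C := by simp
    rw [e₁] at h
    simpa using h
  · have e₂ : (F ≫ e.hom) ≫ e.inv ≫ g = F ≫ g := by simp
    rw [e₂]
    exact h₂

/-! ### Marked equivalences which are injective on objects -/

section Equivalence

variable {F : A ⟶ B}

theorem isEquivalence_of_markedEquivalences
    (hF : markedEquivalences (𝟭 MStarCat.{v, u}) F) : F.toFunctor.IsEquivalence := by
  obtain ⟨g, ⟨e₁, _⟩, ⟨e₂, _⟩⟩ := hF
  exact (CategoryTheory.Equivalence.mk F.toFunctor g.toFunctor e₂.symm e₁).isEquivalence_functor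

theorem exists_marked_of_markedEquivalences (hF : markedEquivalences (𝟭 MStarCat.{v, u}) F)
    (b : B.carrier) : ∃ (a : A.carrier) (f : F.obj a ⟶ b), B.marking.marked f := by
  obtain ⟨g, ⟨e₁, he₁⟩, _⟩ := hF
  exact ⟨g.obj b, e₁.hom.app b, he₁ b⟩

/-- Marked equivalences reflect marked morphisms, because the inverse preserves them and the
comparison with the identity is marked. -/
theorem marked_of_map_marked (hF : markedEquivalences (𝟭 MStarCat.{v, u}) F) {a b : A.carrier}
    {f : a ⟶ b} (h : B.marking.marked (F.map f)) : A.marking.marked f := by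
  obtain ⟨g, _, ⟨e, he⟩⟩ := hF
  -- Naturality of `e.inv` recovers `f` from its image under the composite of `F` and `g`.
  have h' : f = e.inv.app a ≫ g.map (F.map f) ≫ e.hom.app b := by
    have := e.inv.naturality f
    exact (Category.comp_id f).symm.trans ((congrArg (f ≫ ·) (e.inv_hom_id_app b).symm).trans
      ((Category.assoc _ _ _).symm.trans ((congrArg (· ≫ e.hom.app b) this).trans
        (Category.assoc _ _ _))))
  rw [h']
  refine A.marking.comp _ _ ?_ (A.marking.comp _ _ (g.map_marked _ h) (he b))
  exact A.marking.marked_inv (e.app a) (he a)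

/-- An object over `b`, up to marked isomorphism. -/
structure MarkedLift (F : A ⟶ B) (b : B.carrier) where
  obj : A.carrier
  hom : F.obj obj ⟶ b
  marked : B.marking.marked hom

/-- The normalisation on the image of `F` is what makes the inverse built from these choices a
strict retraction and not merely one up to isomorphism. -/
theorem exists_markedLift (hF : markedEquivalences (𝟭 MStarCat.{v, u}) F)
    (hi : Function.Injective F.obj) :
    ∃ q : ∀ b, MarkedLift F b, ∀ a, q (F.obj a) = ⟨a, 𝟙 _, B.marking.id _⟩ := by
  classical
  -- For `b` in the image the choice is forced to be the identity lift, transported along `F.obj a =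
  -- b`; injectivity on objects makes this unambiguous.
  have key : ∀ b, ∃ q : MarkedLift F b,
      ∀ a (h : F.obj a = b), q = h ▸ ⟨a, 𝟙 _, B.marking.id _⟩ := by
    intro b
    by_cases hb : ∃ a, F.obj a = b
    · obtain ⟨a, rfl⟩ := hb
      refine ⟨⟨a, 𝟙 _, B.marking.id _⟩, fun a' h => ?_⟩
      obtain rfl := hi h
      rfl
    · obtain ⟨a, f, hf⟩ := exists_marked_of_markedEquivalences hF b
      exact ⟨⟨a, f, hf⟩, fun a h => (hb ⟨a, h⟩).elim⟩
  choose q hq using key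
  exact ⟨q, fun a => hq _ a rfl⟩

/-- Conjugating by the chosen marked morphisms and pulling back along the fully faithful `F` defines
the retraction. It preserves the involution because those morphisms are unitary, and the marking
because `F` reflects it. -/
theorem exists_section (hF : markedEquivalences (𝟭 MStarCat.{v, u}) F)
    (hi : Function.Injective F.obj) : ∃ p : B ⟶ A, F ≫ p = 𝟙 A := by
  obtain ⟨q, hq⟩ := exists_markedLift hF hi
  have := isEquivalence_of_markedEquivalences hF
  have hu : ∀ b, IsUnitary (q b).hom := fun b => B.marking.unitary _ (q b).marked
  let p : MStarCat.Hom B A :=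
    { obj := fun b => (q b).obj
      map := fun {a b} f => F.toFunctor.preimage ((q a).hom ≫ f ≫ dag (q b).hom)
      map_id := fun a => F.toFunctor.map_injective (by
        rw [Functor.map_preimage, CategoryTheory.Functor.map_id, Category.id_comp]
        exact (hu a).1)
      map_comp := fun {a b c} f g => F.toFunctor.map_injective (by
        simp only [Functor.map_preimage, Functor.map_comp, Category.assoc]
        rw [← Category.assoc (dag (q b).hom) (q b).hom, (hu b).2, Category.id_comp])
      map_star := fun {a b} f => F.toFunctor.map_injective (by
        rw [F.map_star]
        simp only [Functor.map_preimage, StarCategory.dag_comp, StarCategory.dag_dag,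
          Category.assoc])
      map_marked := fun {a b} f hf => marked_of_map_marked hF (by
        rw [Functor.map_preimage]
        exact B.marking.comp _ _ (q a).marked (B.marking.comp _ _ hf
          (B.marking.star _ (q b).marked))) }
  have ho : ∀ a, p.obj (F.obj a) = a := fun a => congrArg MarkedLift.obj (hq a)
  refine ⟨p, hom_ext (CategoryTheory.Functor.hext ho fun a b f => ?_)⟩
  -- The endpoints of the two morphisms agree only through `ho`, so they are compared
  -- heterogeneously, after applying the faithful `F`.
  refine F.toFunctor.map_heq_cancel (ho a) (ho b) ?_
  change HEq (F.map (F.toFunctor.preimage _)) _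
  rw [Functor.map_preimage]
  -- With arbitrary lifts in place of the chosen ones, the normalisation can be substituted and both
  -- conjugating morphisms become identities.
  have aux : ∀ (r : MarkedLift F (F.obj a)) (s : MarkedLift F (F.obj b)),
      r = ⟨a, 𝟙 _, B.marking.id _⟩ → s = ⟨b, 𝟙 _, B.marking.id _⟩ →
        HEq (r.hom ≫ F.map f ≫ dag s.hom) (F.map f) := by
    rintro _ _ rfl rfl
    rw [StarCategory.dag_id, Category.comp_id, Category.id_comp]
  exact aux _ _ (hq a) (hq b)

end Equivalence

/-! ### Extension of natural transformations along equivalences -/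

/-- Natural transformations between morphisms of marked `*`-categories. -/
abbrev Cell (F H : A ⟶ B) : Type _ := F.toFunctor ⟶ H.toFunctor

/-- Whiskering with a morphism on the source. -/
abbrev preWhisker (K : A ⟶ B) {F H : B ⟶ C} (t : Cell F H) : Cell (K ≫ F) (K ≫ H) :=
  Functor.whiskerLeft K.toFunctor t

/-- Whiskering with a morphism on the target. -/
abbrev postWhisker {F H : A ⟶ B} (t : Cell F H) (K : B ⟶ C) : Cell (F ≫ K) (H ≫ K) :=
  Functor.whiskerRight t K.toFunctor

/-- A strict lifting problem involves functors that are equal without being definitionally equal, so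
transformations between them are compared by `HEq`. This lemma and the next ones carry such
comparisons through whiskering, composition and components. -/
theorem preWhisker_heq {K K' : A ⟶ B} (hK : K = K') {F F' H H' : B ⟶ C} (hF : F = F')
    (hH : H = H') {t : Cell F H} {t' : Cell F' H'} (h : HEq t t') :
    HEq (preWhisker K t) (preWhisker K' t') := by
  subst hK hF hH
  rw [eq_of_heq h]

theorem postWhisker_heq {K K' : B ⟶ C} (hK : K = K') {F F' H H' : A ⟶ B} (hF : F = F')
    (hH : H = H') {t : Cell F H} {t' : Cell F' H'} (h : HEq t t') :
    HEq (postWhisker t K) (postWhisker t' K') := by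
  subst hK hF hH
  rw [eq_of_heq h]

theorem cell_comp_heq {F F' H H' K K' : A ⟶ B} (hF : F = F') (hH : H = H') (hK : K = K')
    {t : Cell F H} {t' : Cell F' H'} {s : Cell H K} {s' : Cell H' K'} (h : HEq t t')
    (h' : HEq s s') : HEq (t ≫ s) (t' ≫ s') := by
  subst hF hH hK
  rw [eq_of_heq h, eq_of_heq h']

theorem cell_id_heq {F F' : A ⟶ B} (hF : F = F') :
    HEq (𝟙 F.toFunctor) (𝟙 F'.toFunctor) := by
  subst hF
  rfl

theorem cell_app_heq {F F' H H' : A ⟶ B} (hF : F = F') (hH : H = H')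
    {t : Cell F H} {t' : Cell F' H'} (h : HEq t t') (a : A.carrier) :
    HEq (NatTrans.app t a) (NatTrans.app t' a) := by
  subst hF hH
  rw [eq_of_heq h]

section Extend

variable {F : A ⟶ B} [F.toFunctor.IsEquivalence]

/-- Precomposition with an equivalence is fully faithful. -/
noncomputable def precompFullyFaithful (F : A ⟶ B) [F.toFunctor.IsEquivalence]
    (C : MStarCat.{v, u}) :
    ((Functor.whiskeringLeft _ _ C.carrier).obj F.toFunctor).FullyFaithful :=
  F.toFunctor.asEquivalence.symm.congrLeft.fullyFaithfulFunctor

/-- Uniqueness of extensions along `F`: precomposition with an equivalence is faithful. -/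
theorem preWhisker_heq_cancel {H H' K K' : B ⟶ C} (hH : H = H') (hK : K = K') {t : Cell H K}
    {t' : Cell H' K'} (h : HEq (preWhisker F t) (preWhisker F t')) : HEq t t' := by
  subst hH hK
  exact heq_of_eq ((precompFullyFaithful F C).map_injective (eq_of_heq h))

/-- Existence of extensions along `F`: precomposition with an equivalence is full. -/
theorem exists_preWhisker_heq {H K : B ⟶ C} {H' K' : A ⟶ C} (hH : F ≫ H = H')
    (hK : F ≫ K = K') (s : Cell H' K') : ∃ t : Cell H K, HEq (preWhisker F t) s := by
  subst hH hK
  exact ⟨(precompFullyFaithful F C).preimage s,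
    heq_of_eq ((precompFullyFaithful F C).map_preimage s)⟩

end Extend

/-- A transformation is marked if it is so after precomposition with a marked equivalence. -/
theorem marked_app_of_preWhisker {F : A ⟶ B} (hF : markedEquivalences (𝟭 MStarCat.{v, u}) F)
    {H K : B ⟶ C} (t : Cell H K)
    (h : ∀ a, C.marking.marked (NatTrans.app (preWhisker F t) a)) (b : B.carrier) :
    C.marking.marked (NatTrans.app t b) := by
  obtain ⟨a, f, hf⟩ := exists_marked_of_markedEquivalences hF b
  -- By naturality, the component at `b` is a component over `A` conjugated by images of the marked
  -- `f`.
  have e : NatTrans.app t b = H.map (dag f) ≫ NatTrans.app t (F.obj a) ≫ K.map f := by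
    rw [← NatTrans.naturality, ← Category.assoc, ← Functor.map_comp,
      (B.marking.unitary _ hf).2, CategoryTheory.Functor.map_id, Category.id_comp]
  rw [e]
  exact C.marking.comp _ _ (H.map_marked _ (B.marking.star _ hf))
    (C.marking.comp _ _ (h a) (K.map_marked _ hf))

end MStarCat

/-! ### Morphisms to categories of marked functors on the contractible groupoid -/

namespace MStarCat

/-- The marked `*`-category `Fun^u` of the contractible groupoid. -/
abbrev uFun (G : Type v) (Z : MStarCat.{v, max v u}) : MStarCat.{v, max v u} :=
  ⟨UFun (GTilde G) Z.marking, UFun.marking (GTilde G) Z.marking⟩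

section UFun

variable {G : Type v} {Y Z : MStarCat.{v, max v u}}

/-- Evaluation at an object of the contractible groupoid. -/
def ev (x : G) (Z : MStarCat.{v, max v u}) : uFun.{v, u} G Z ⟶ Z :=
  ({ obj := fun a => a.toFunctor.obj ⟨x⟩
     map := fun f => NatTrans.app f ⟨x⟩
     map_id := fun _ => rfl
     map_comp := fun _ _ => rfl
     map_star := fun _ => rfl
     map_marked := fun _ hf => hf ⟨x⟩ } : MStarCat.Hom (uFun.{v, u} G Z) Z)

/-- The natural transformation between evaluations at two objects. -/
def evTrans (x y : G) (Z : MStarCat.{v, max v u}) : Cell (ev.{v, u} x Z) (ev.{v, u} y Z) where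
  app a := a.toFunctor.map (PUnit.unit : (⟨x⟩ : GTilde G) ⟶ ⟨y⟩)
  naturality _ _ f := (NatTrans.naturality f _).symm

theorem evTrans_self (x : G) (Z : MStarCat.{v, max v u}) :
    evTrans.{v, u} x x Z = 𝟙 _ :=
  NatTrans.ext (funext fun a => a.toFunctor.map_id _)

theorem evTrans_comp (x y z : G) (Z : MStarCat.{v, max v u}) :
    evTrans.{v, u} x y Z ≫ evTrans.{v, u} y z Z = evTrans.{v, u} x z Z :=
  NatTrans.ext (funext fun a => (a.toFunctor.map_comp _ _).symm)

/-- The connecting morphisms between the values are part of a functor on the contractible groupoid,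
so agreement of all evaluations does not suffice and `ht` is needed to identify the objects.
Agreement on morphisms then follows from the evaluations alone. -/
theorem uFun_hom_ext {F H : Y ⟶ uFun.{v, u} G Z}
    (h : ∀ x, F ≫ ev.{v, u} x Z = H ≫ ev.{v, u} x Z)
    (ht : ∀ x y, HEq (preWhisker F (evTrans.{v, u} x y Z)) (preWhisker H (evTrans.{v, u} x y Z))) :
    F = H := by
  have ho : ∀ a, F.obj a = H.obj a := fun a =>
    UFun.ext' (CategoryTheory.Functor.hext
      (fun x => congrArg (fun K : Y ⟶ Z => K.obj a) (h x.el))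
      (fun x y φ => cell_app_heq (h x.el) (h y.el) (ht x.el y.el) a))
  have aux : ∀ {a a' b b' : UFun (GTilde G) Z.marking} (_ : a = a') (_ : b = b') (f : a ⟶ b)
      (f' : a' ⟶ b') (_ : ∀ x, HEq (NatTrans.app f x) (NatTrans.app f' x)), HEq f f' := by
    rintro a _ b _ rfl rfl f f' hf
    exact heq_of_eq (NatTrans.ext (funext fun x => eq_of_heq (hf x)))
  have hm : ∀ {K L : Y ⟶ Z} (_ : K = L) {a b : Y.carrier} (f : a ⟶ b),
      HEq (K.map f) (L.map f) := by
    rintro K _ rfl a b f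
    rfl
  exact hom_ext (CategoryTheory.Functor.hext ho fun a b f =>
    aux (ho a) (ho b) _ _ fun x => hm (h x.el) f)

/-- The morphism to `Fun^u` given by compatible morphisms and natural transformations. -/
def toUFun (F : G → (Y ⟶ Z)) (t : ∀ x y, Cell (F x) (F y)) (t_self : ∀ x, t x x = 𝟙 _)
    (t_comp : ∀ x y z, t x y ≫ t y z = t x z)
    (t_marked : ∀ x y a, Z.marking.marked (NatTrans.app (t x y) a)) : Y ⟶ uFun.{v, u} G Z :=
  ({ obj := fun a =>
      { toFunctor :=
          { obj := fun x => (F x.el).obj a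
            map := fun {x y} _ => NatTrans.app (t x.el y.el) a
            map_id := fun x => congrArg (fun s => NatTrans.app s a) (t_self x.el)
            map_comp := fun {x y z} _ _ =>
              congrArg (fun s => NatTrans.app s a) (t_comp x.el y.el z.el).symm }
        marked := fun {x y} _ => t_marked x.el y.el a }
     map := fun f =>
      { app := fun x => (F x.el).map f
        naturality := fun x y _ => (NatTrans.naturality (t x.el y.el) f).symm }
     map_id := fun a => NatTrans.ext (funext fun x => (F x.el).map_id a)
     map_comp := fun f g => NatTrans.ext (funext fun x => (F x.el).map_comp f g)
     map_star := fun f => NatTrans.ext (funext fun x => (F x.el).map_star f)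
     map_marked := fun f hf x => (F x.el).map_marked f hf } :
    MStarCat.Hom Y (uFun.{v, u} G Z))

end UFun

/-! ### The case of marked `*`-categories -/

section Base

variable {G : Type v} [Group G]

/-- Lifting of a map against trivial cofibrations. -/
theorem exists_lift_funTilde {C D Z : SingleObj G ⥤ MStarCat.{v, max v u}} (i : C ⟶ D)
    (hi : markedEquivalences (𝟭 MStarCat.{v, max v u}) (i.app (SingleObj.star G)))
    (hi' : Function.Injective (i.app (SingleObj.star G)).obj)
    (f : C ⟶ (funTilde.{v, u} G).onGObjects.obj Z) :
    ∃ h : D ⟶ (funTilde.{v, u} G).onGObjects.obj Z, i ≫ h = f := by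
  let o : SingleObj G := SingleObj.star G
  let I : C.obj o ⟶ D.obj o := i.app o
  let Φ : C.obj o ⟶ uFun.{v, u} G (Z.obj o) := f.app o
  let a : ∀ (X : SingleObj G ⥤ MStarCat.{v, max v u}) (_ : G), X.obj o ⟶ X.obj o :=
    fun X g => X.map (X := o) (Y := o) g
  let r : G → (uFun.{v, u} G (Z.obj o) ⟶ uFun.{v, u} G (Z.obj o)) := fun g =>
    ((funTilde.{v, u} G).onGObjects.obj Z).map (X := o) (Y := o) g
  have ha : ∀ X g h, a X h ≫ a X g = a X (g * h) := fun X g h =>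
    (X.map_comp (X := o) (Y := o) (Z := o) h g).symm
  have ha₁ : ∀ X, a X 1 = 𝟙 _ := fun X => X.map_id o
  have hI : ∀ g, a C g ≫ I = I ≫ a D g := fun g => i.naturality (X := o) (Y := o) g
  have hΦ : ∀ g, a C g ≫ Φ = Φ ≫ r g := fun g => f.naturality (X := o) (Y := o) g
  -- The element `g` acts on `Fun^u` by precomposition with left multiplication by `g⁻¹`, followed
  -- by its action on `Z`.
  have hR : ∀ g x, r g ≫ ev.{v, u} x (Z.obj o) = ev.{v, u} (g⁻¹ * x) (Z.obj o) ≫ a Z g :=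
    fun g x => rfl
  have : I.toFunctor.IsEquivalence := isEquivalence_of_markedEquivalences hi
  obtain ⟨p, hp⟩ := exists_section hi hi'
  -- The retraction `p` need not be equivariant; at `x` it is replaced by its conjugate by `x`.
  let F : G → (D.obj o ⟶ Z.obj o) := fun x =>
    a D x⁻¹ ≫ p ≫ a C x ≫ Φ ≫ ev.{v, u} x (Z.obj o)
  -- Equivariance of `I` moves `x⁻¹` past it; then `p` cancels against `I`, and `x⁻¹` against `x`.
  have hF : ∀ x, I ≫ F x = Φ ≫ ev.{v, u} x (Z.obj o) := by
    intro x
    change I ≫ a D x⁻¹ ≫ p ≫ a C x ≫ Φ ≫ ev.{v, u} x (Z.obj o) = _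
    rw [← Category.assoc, ← hI, Category.assoc, ← Category.assoc I p, hp, Category.id_comp,
      ← Category.assoc (a C x⁻¹), ha, mul_inv_cancel, ha₁, Category.id_comp]
  -- The connecting transformations of `Φ` are extended along `I`. Since the extension is unique,
  -- every later identity between the `t x y` can be checked after restriction along `I`.
  have key : ∀ x y, ∃ t : Cell (F x) (F y),
      HEq (preWhisker I t) (preWhisker Φ (evTrans.{v, u} x y (Z.obj o))) :=
    fun x y => exists_preWhisker_heq (hF x) (hF y) _
  choose t ht using key
  have t_self : ∀ x, t x x = 𝟙 _ := fun x => eq_of_heq <|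
    preWhisker_heq_cancel (F := I) rfl rfl <| (ht x x).trans <| by
      rw [evTrans_self]
      exact cell_id_heq (hF x).symm
  have t_comp : ∀ x y z, t x y ≫ t y z = t x z := fun x y z => eq_of_heq <|
    preWhisker_heq_cancel (F := I) rfl rfl <| by
      refine HEq.trans ?_ (ht x z).symm
      rw [← evTrans_comp x y z]
      exact cell_comp_heq (hF x) (hF y) (hF z) (ht x y) (ht y z)
  have t_marked : ∀ x y b, (Z.obj o).marking.marked (NatTrans.app (t x y) b) := fun x y =>
    marked_app_of_preWhisker hi (t x y) fun c => by
      refine Marking.marked_of_heq _ ?_ ?_ (cell_app_heq (hF x) (hF y) (ht x y) c).symm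
        ((Φ.obj c).marked _)
      · exact congrArg (fun K : C.obj o ⟶ Z.obj o => K.obj c) (hF x).symm
      · exact congrArg (fun K : C.obj o ⟶ Z.obj o => K.obj c) (hF y).symm
  let H : D.obj o ⟶ uFun.{v, u} G (Z.obj o) := toUFun.{v, u} F t t_self t_comp t_marked
  have hIH : I ≫ H = Φ := uFun_hom_ext.{v, u} hF ht
  -- Both sides run through the same conjugate of `p`: on `D` one has `(g⁻¹ * x)⁻¹ = x⁻¹ * g`, and
  -- equivariance of `Φ` turns the final action of `g` on `Z` into one on `C`, which combines with
  -- `g⁻¹ * x` to `x`.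
  have hFg : ∀ g x, a D g ≫ F x = F (g⁻¹ * x) ≫ a Z g := by
    intro g x
    change a D g ≫ a D x⁻¹ ≫ p ≫ a C x ≫ Φ ≫ ev.{v, u} x (Z.obj o) =
      a D (g⁻¹ * x)⁻¹ ≫ p ≫ a C (g⁻¹ * x) ≫ Φ ≫ (ev.{v, u} (g⁻¹ * x) (Z.obj o) ≫ a Z g)
    have e : Φ ≫ (ev.{v, u} (g⁻¹ * x) (Z.obj o) ≫ a Z g) =
        a C g ≫ Φ ≫ ev.{v, u} x (Z.obj o) := by
      rw [← hR, ← Category.assoc, ← hΦ, Category.assoc]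
    rw [e, ← Category.assoc (a C _) (a C g), ha, ← Category.assoc (a D g), ha]
    simp
  have hHg : ∀ g, a D g ≫ H = H ≫ r g := by
    intro g
    refine uFun_hom_ext.{v, u} (hFg g) fun x y => ?_
    -- After restriction along `I`, the remaining identity is the equivariance of the connecting
    -- transformations of `Φ`: `h₁`, `h₂`, `h₃` rewrite the left side, and `h₄` the right side.
    refine preWhisker_heq_cancel (F := I) (hFg g x) (hFg g y) ?_
    have h₁ : HEq (preWhisker I (preWhisker (a D g) (t x y)))
        (preWhisker (a C g) (preWhisker I (t x y))) :=
      preWhisker_heq (K := I ≫ a D g) (K' := a C g ≫ I) (hI g).symm rfl rfl HEq.rfl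
    have h₂ : HEq (preWhisker (a C g) (preWhisker I (t x y)))
        (preWhisker (a C g) (preWhisker Φ (evTrans.{v, u} x y (Z.obj o)))) :=
      preWhisker_heq rfl (hF x) (hF y) (ht x y)
    have h₃ : HEq (preWhisker (a C g) (preWhisker Φ (evTrans.{v, u} x y (Z.obj o))))
        (preWhisker Φ (preWhisker (r g) (evTrans.{v, u} x y (Z.obj o)))) :=
      preWhisker_heq (K := a C g ≫ Φ) (K' := Φ ≫ r g) (hΦ g) rfl rfl
        (t := evTrans.{v, u} x y (Z.obj o)) (t' := evTrans.{v, u} x y (Z.obj o)) HEq.rfl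
    have h₄ : HEq (postWhisker (preWhisker I (t (g⁻¹ * x) (g⁻¹ * y))) (a Z g))
        (postWhisker (preWhisker Φ (evTrans.{v, u} (g⁻¹ * x) (g⁻¹ * y) (Z.obj o))) (a Z g)) :=
      postWhisker_heq rfl (hF _) (hF _) (ht _ _)
    exact (h₁.trans (h₂.trans h₃)).trans h₄.symm
  -- Since `SingleObj G` has only one object, `H` serves as every component.
  exact ⟨{ app := fun _ => H, naturality := fun _ _ g => hHg g },
    NatTrans.ext (funext fun _ => hIH)⟩

/-- Evaluation at `1` is the inverse. It is a strict one on constant functors, and the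
transformation `UFun.fromConst` is marked because its components are values of a marked functor. -/
theorem markedEquivalences_const (A : MStarCat.{v, max v u}) :
    markedEquivalences (𝟭 MStarCat.{v, max v u})
      (show A ⟶ uFun.{v, u} G A from MStarCat.const (GTilde G) A) := by
  refine ⟨ev.{v, u} (1 : G) A, ⟨NatIso.ofComponents (fun a => ?_) ?_, fun a => ?_⟩,
    markedIsomorphic_of_eq rfl⟩
  · have hu : IsUnitary (A := UFun (GTilde G) A.marking)
        (a := (MStarCat.const (GTilde G) A).obj (a.toFunctor.obj ⟨1⟩)) (b := a) a.fromConst :=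
      (UFun.marking (GTilde G) A.marking).unitary _ (fun g => a.marked _)
    exact ⟨a.fromConst, dag (A := UFun (GTilde G) A.marking) a.fromConst, hu.1, hu.2⟩
  · intro a b f
    exact (UFun.fromConst_comp f).symm
  · exact fun g => a.marked _

end Base

end MStarCat

/-! ### Comparison of endofunctors with an action -/

namespace GFunctor

variable {G : Type v} [Group G] {C : Type u} [Category.{w} C] {D : Type u₁} [Category.{v₁} D]
  {E : Type u₂} [Category.{v₂} E]

/-- An identification of `S` with `T` along a functor `V`. -/
structure Comparison (T : GFunctor G C) (V : C ⥤ D) (S : GFunctor G D) where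
  iso : ∀ i, V ⋙ S.act.obj i ≅ T.act.obj i ⋙ V
  act : ∀ {i j : SingleObj G} (g : i ⟶ j) (A : C),
    (S.act.map g).app (V.obj A) ≫ (iso j).hom.app A =
      (iso i).hom.app A ≫ V.map ((T.act.map g).app A)
  unit : ∀ i (A : C), (S.unit.app i).app (V.obj A) ≫ (iso i).hom.app A =
    V.map ((T.unit.app i).app A)

namespace Comparison

variable {T : GFunctor G C} {V : C ⥤ D} {S : GFunctor G D} {W : D ⥤ E} {R : GFunctor G E}

/-- Composition of comparisons. -/
def comp (c : T.Comparison V S) (d : S.Comparison W R) : T.Comparison (V ⋙ W) R where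
  iso i := Functor.isoWhiskerLeft V (d.iso i) ≪≫ Functor.isoWhiskerRight (c.iso i) W
  act {i j} g A := by
    have h := d.act g (V.obj A)
    have h' := congrArg W.map (c.act g A)
    rw [W.map_comp, W.map_comp] at h'
    change (R.act.map g).app (W.obj (V.obj A)) ≫ (d.iso j).hom.app (V.obj A) ≫
      W.map ((c.iso j).hom.app A) = ((d.iso i).hom.app (V.obj A) ≫
      W.map ((c.iso i).hom.app A)) ≫ W.map (V.map ((T.act.map g).app A))
    rw [Category.assoc]
    exact (Category.assoc _ _ _).symm.trans ((congrArg (· ≫ W.map ((c.iso j).hom.app A)) h).trans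
      ((Category.assoc _ _ _).trans (congrArg ((d.iso i).hom.app (V.obj A) ≫ ·) h')))
  unit i A := by
    have h := d.unit i (V.obj A)
    have h' := congrArg W.map (c.unit i A)
    exact (Category.assoc _ _ _).symm.trans
      ((congrArg (· ≫ W.map ((c.iso i).hom.app A)) h).trans ((W.map_comp _ _).symm.trans h'))

/-- The comparison on `G`-objects. -/
def onGObjectsIso (c : T.Comparison V S) (X : SingleObj G ⥤ C) :
    S.onGObjects.obj (X ⋙ V) ≅ T.onGObjects.obj X ⋙ V :=
  NatIso.ofComponents (fun i => (c.iso i).app (X.obj i)) (fun {i j} g => by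
    have h := c.act g (X.obj i)
    have h' := (c.iso j).hom.naturality (X.map g)
    change ((S.act.map g).app (V.obj (X.obj i)) ≫ (S.act.obj j).map (V.map (X.map g))) ≫
      (c.iso j).hom.app (X.obj j) = (c.iso i).hom.app (X.obj i) ≫
        V.map ((T.act.map g).app (X.obj i) ≫ (T.act.obj j).map (X.map g))
    rw [V.map_comp, Category.assoc]
    exact (congrArg ((S.act.map g).app (V.obj (X.obj i)) ≫ ·) h').trans
      ((Category.assoc _ _ _).symm.trans
      ((congrArg (· ≫ V.map ((T.act.obj j).map (X.map g))) h).trans (Category.assoc _ _ _))))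

end Comparison

/-- The comparison along `L` of a conjugate with the original. -/
noncomputable def conjComparison (S : GFunctor G D) {L : C ⥤ D} {R : D ⥤ C} {η : 𝟭 C ⟶ L ⋙ R}
    (δ : 𝟭 D ⟶ R ⋙ L) (h : ∀ A, L.map (η.app A) = δ.app (L.obj A))
    (hδ : ∀ i A, IsIso (δ.app ((S.act.obj i).obj (L.obj A)))) :
    (S.conj L R η).Comparison L S where
  iso i := NatIso.ofComponents
    -- The conjugate followed by `L` is `R ⋙ L` applied to the values of `S`, so `δ` itself is the
    -- comparison. Only its components at values of `S` on objects `L.obj A` have to be invertible,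
    -- which matters since `δ` need not be an isomorphism elsewhere.
    (fun A => @asIso _ _ _ _ (δ.app ((S.act.obj i).obj (L.obj A))) (hδ i A))
    (fun f => δ.naturality ((S.act.obj i).map (L.map f)))
  act g A := δ.naturality ((S.act.map g).app (L.obj A))
  unit i A := by
    -- Naturality moves `δ` to the source of the unit, where `h` identifies it with the image of
    -- `η`.
    have h₁ := δ.naturality ((S.unit.app i).app (L.obj A))
    refine Eq.trans h₁ ?_
    change _ = L.map (η.app A ≫ R.map ((S.unit.app i).app (L.obj A)))
    rw [L.map_comp, h]
    rfl

end GFunctor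

/-! ### Transfer along functors to marked `*`-categories -/

section Transfer

variable {C : Type u₁} [Category.{v₁} C] {D : Type u₂} [Category.{v₂} D]

/-- Functors to marked `*`-categories along which inverses of marked equivalences and extensions
along marked equivalences lift. -/
structure LiftsMarkedEquivalences (V : C ⥤ MStarCat.{v, u}) : Prop where
  faithful : V.Faithful
  inverse : ∀ {A B : C} (f : A ⟶ B), markedEquivalences (𝟭 MStarCat.{v, u}) (V.map f) →
    markedEquivalences V f
  extension : ∀ {A B X : C} (i : A ⟶ B) (f : A ⟶ X) (h : V.obj B ⟶ V.obj X),
    markedEquivalences V i → V.map i ≫ h = V.map f → ∃ k : B ⟶ X, V.map k = h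

theorem LiftsMarkedEquivalences.id : LiftsMarkedEquivalences (𝟭 MStarCat.{v, u}) where
  faithful := inferInstance
  inverse _ hf := hf
  extension _ _ h _ _ := ⟨h, rfl⟩

/-- Morphisms of `D` between objects in the image of `J` come from `C`. This covers both the full
subcategories of (pre-)`C*`-categories and the functors that mark all unitaries. -/
theorem LiftsMarkedEquivalences.comp {V : D ⥤ MStarCat.{v, u}} (hV : LiftsMarkedEquivalences V)
    (J : C ⥤ D) [J.Full] [J.Faithful] : LiftsMarkedEquivalences (J ⋙ V) where
  faithful := have := hV.faithful; inferInstance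
  inverse f hf := by
    obtain ⟨g, h₁, h₂⟩ := hV.inverse (J.map f) hf
    refine ⟨J.preimage g, ?_, ?_⟩
    · change MarkedIsomorphic (V.map (J.map _)) (V.map (J.map _))
      rw [J.map_comp, J.map_preimage, J.map_id]
      exact h₁
    · change MarkedIsomorphic (V.map (J.map _)) (V.map (J.map _))
      rw [J.map_comp, J.map_preimage, J.map_id]
      exact h₂
  extension i f h hi hf := by
    have hi' : markedEquivalences V (J.map i) := by
      obtain ⟨g, h₁, h₂⟩ := hi
      change MarkedIsomorphic (V.map (J.map _)) (V.map (J.map _)) at h₁ h₂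
      rw [J.map_comp, J.map_id] at h₁ h₂
      exact ⟨J.map g, h₁, h₂⟩
    obtain ⟨k, hk⟩ := hV.extension (J.map i) (J.map f) h hi' hf
    exact ⟨J.preimage k, (congrArg V.map (J.map_preimage k)).trans hk⟩

theorem markedEquivalences_map {V : C ⥤ MStarCat.{v, u}} {A B : C} {f : A ⟶ B}
    (hf : markedEquivalences V f) : markedEquivalences (𝟭 MStarCat.{v, u}) (V.map f) := by
  obtain ⟨g, h₁, h₂⟩ := hf
  rw [V.map_comp, V.map_id] at h₁ h₂
  exact ⟨V.map g, h₁, h₂⟩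

/-- The transfer of the case of marked `*`-categories. -/
theorem GFunctor.Comparison.isInjectiveFibrantReplacement {G : Type v} [Group G]
    {V : C ⥤ MStarCat.{v, max v u}} [Limits.HasTerminal C] {T : GFunctor G C}
    (c : T.Comparison V (MStarCat.funTilde.{v, u} G)) (hV : LiftsMarkedEquivalences V) :
    IsInjectiveFibrantReplacement V T.onGObjects T.unitOnGObjects where
  weakEquivalence X i := by
    -- It suffices to find an inverse after applying `V`, where the unit becomes the
    -- constant-functor morphism followed by the comparison isomorphism.
    refine hV.inverse _ ?_
    have h := MStarCat.markedEquivalences_comp_iso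
      (MStarCat.markedEquivalences_const.{v, u} (G := G) (V.obj (X.obj i)))
      ((c.iso i).app (X.obj i))
    have e := c.unit i (X.obj i)
    change markedEquivalences _ (V.map ((T.unit.app i).app (X.obj i)))
    rw [← e]
    exact h
  fibrant X := by
    -- Over a terminal object the lower triangle of a lifting square commutes automatically, so only
    -- an extension of `f` along `i` is needed.
    refine ⟨⊤_ _, Limits.terminalIsTerminal, fun {A B} i hi => ⟨fun {f b} sq => ?_⟩⟩
    let e := c.onGObjectsIso X
    let f' : A ⋙ V ⟶ T.onGObjects.obj X ⋙ V := Functor.whiskerRight f V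
    let i' : A ⋙ V ⟶ B ⋙ V := Functor.whiskerRight i V
    obtain ⟨h, hh⟩ := MStarCat.exists_lift_funTilde.{v, u} i'
      (markedEquivalences_map (hi.1 (SingleObj.star G))) (hi.2 (SingleObj.star G)) (f' ≫ e.inv)
    have hh' : i' ≫ h ≫ e.hom = f' := by
      rw [← Category.assoc, hh, Category.assoc, e.inv_hom_id, Category.comp_id]
    have hx : ∀ j, V.map (i.app j) ≫ (h ≫ e.hom).app j = V.map (f.app j) := fun j =>
      congrArg (fun s => NatTrans.app s j) hh'
    -- The extension found among marked `*`-categories is brought back to `C` one component at a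
    -- time; faithfulness of `V` then gives naturality and the upper triangle.
    choose k hk using fun j => hV.extension (i.app j) (f.app j) ((h ≫ e.hom).app j) (hi.1 j) (hx j)
    have := hV.faithful
    refine ⟨⟨{
      l := { app := k, naturality := fun j j' g => V.map_injective ?_ }
      fac_left := NatTrans.ext (funext fun j => V.map_injective ?_)
      fac_right := Limits.terminalIsTerminal.hom_ext _ _ }⟩⟩
    · rw [V.map_comp, V.map_comp, hk, hk]
      exact (h ≫ e.hom).naturality g
    · change V.map (i.app j ≫ k j) = V.map (f.app j)
      rw [V.map_comp, hk, hx]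

end Transfer

/-! ### Forgetting the linear structure -/

namespace MCLinStarCat

/-- The functor underlying a morphism of marked `*`-categories between marked `ℂ`-linear
`*`-categories. -/
abbrev underlying {A B : MCLinStarCat.{v, u}} (h : toMStarCat.obj A ⟶ toMStarCat.obj B) :
    A.carrier ⥤ B.carrier := h.toFunctor

theorem exists_map_eq {A B : MCLinStarCat.{v, u}} (h : toMStarCat.obj A ⟶ toMStarCat.obj B)
    (ha : (underlying h).Additive) (hl : (underlying h).Linear ℂ) :
    ∃ k : A ⟶ B, toMStarCat.map k = h :=
  ⟨({ h with
      map_add := fun _ _ => ha.map_add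
      map_smul := fun c f => hl.map_smul f c } : MCLinStarCat.Hom A B), rfl⟩

theorem underlying_additive {A B : MCLinStarCat.{v, u}} (f : A ⟶ B) :
    (underlying (toMStarCat.map f)).Additive := ⟨f.map_add _ _⟩

theorem underlying_linear {A B : MCLinStarCat.{v, u}} (f : A ⟶ B) :
    (underlying (toMStarCat.map f)).Linear ℂ := ⟨fun s r => f.map_smul r s⟩

/-- Linearity is automatic along equivalences. For the inverse, the composite with the linear
faithful `F` is isomorphic to the identity, hence linear. For an extension, the composite with the
full and essentially surjective `i` is linear. -/
theorem liftsMarkedEquivalences_toMStarCat :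
    LiftsMarkedEquivalences toMStarCat.{v, u} where
  faithful := ⟨fun {A B F H} h => hom_ext (congrArg (fun K : toMStarCat.obj A ⟶ toMStarCat.obj B =>
    K.toFunctor) h)⟩
  inverse {A B} F hF := by
    have : (underlying (toMStarCat.map F)).IsEquivalence :=
      MStarCat.isEquivalence_of_markedEquivalences hF
    have := underlying_additive F
    have := underlying_linear F
    obtain ⟨g, ⟨e, he⟩, h⟩ := hF
    let g' : toMStarCat.obj B ⟶ toMStarCat.obj A := g
    let e' : 𝟭 B.carrier ≅ underlying g' ⋙ underlying (toMStarCat.map F) := e.symm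
    have : (underlying g' ⋙ underlying (toMStarCat.map F)).Additive := Functor.additive_of_iso e'
    have : (underlying g' ⋙ underlying (toMStarCat.map F)).Linear ℂ := Functor.linear_of_iso ℂ e'
    have ha : (underlying g').Additive :=
      Functor.additive_of_comp_faithful _ (underlying (toMStarCat.map F))
    obtain ⟨k, rfl⟩ := exists_map_eq g' ha
      ⟨fun f r => (underlying (toMStarCat.map F)).map_injective <|
        ((underlying g' ⋙ underlying (toMStarCat.map F)).map_smul r f).trans
          ((underlying (toMStarCat.map F)).map_smul r _).symm⟩
    exact ⟨k, ⟨e, he⟩, h⟩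
  extension {A B X} i f h hi hf := by
    have : (underlying (toMStarCat.map i)).IsEquivalence :=
      MStarCat.isEquivalence_of_markedEquivalences (markedEquivalences_map hi)
    have e : underlying (toMStarCat.map i) ⋙ underlying h = underlying (toMStarCat.map f) :=
      congrArg (fun K : toMStarCat.obj A ⟶ toMStarCat.obj X => underlying K) hf
    have := underlying_additive i
    have := underlying_linear i
    have : (underlying (toMStarCat.map i) ⋙ underlying h).Additive := e ▸ underlying_additive f
    have : (underlying (toMStarCat.map i) ⋙ underlying h).Linear ℂ := e ▸ underlying_linear f
    exact exists_map_eq h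
      (Functor.additive_of_full_essSurj_comp (underlying (toMStarCat.map i)) (underlying h))
      (Functor.linear_of_full_essSurj_comp (underlying (toMStarCat.map i)) (underlying h))

/-- Forgetting the linear structure commutes with `Fun^u`. -/
def funTildeComparison (G : Type v) [Group G] :
    (funTilde.{v, u} G).Comparison toMStarCat (MStarCat.funTilde.{v, u} G) where
  iso i := NatIso.ofComponents
    (fun A => Iso.refl (toMStarCat.obj (((funTilde.{v, u} G).act.obj i).obj A))) (fun _ => rfl)
  act _ _ := rfl
  unit _ _ := rfl

end MCLinStarCat

/-! ### Terminal objects -/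

/-- The type of objects of the terminal category. -/
inductive PointCat : Type u
  | point

namespace PointCat

instance : Subsingleton PointCat.{u} := ⟨fun ⟨⟩ ⟨⟩ => rfl⟩

instance : Category.{v} PointCat.{u} where
  Hom _ _ := PUnit.{v + 1}
  id _ := ⟨⟩
  comp _ _ := ⟨⟩

instance (a b : PointCat.{u}) : Subsingleton (a ⟶ b) := inferInstanceAs (Subsingleton PUnit)

/-- The only morphism is both identity and zero. Its maximal norm is therefore zero, and this one
category is terminal in all eight cases. -/
instance : CLinStarCategory.{v} PointCat.{u} where
  homGroup _ _ := inferInstanceAs (AddCommGroup PUnit.{v + 1})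
  homModule _ _ := inferInstanceAs (Module ℂ PUnit.{v + 1})
  add_comp _ _ _ _ _ _ := rfl
  comp_add _ _ _ _ _ _ := rfl
  smul_comp _ _ _ _ _ _ := rfl
  comp_smul _ _ _ _ _ _ := rfl
  dag _ := ⟨⟩
  dag_dag _ := rfl
  dag_id _ := rfl
  dag_comp _ _ := rfl
  dag_add _ _ := rfl
  dag_smul _ _ := rfl

theorem functor_ext {A : Type u₁} [Category.{v₁} A] (F H : A ⥤ PointCat.{u}) : F = H :=
  CategoryTheory.Functor.ext (fun _ => Subsingleton.elim _ _) (fun _ _ _ => Subsingleton.elim _ _)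

theorem isUnitary {a b : PointCat.{u}} (f : a ⟶ b) : IsUnitary f :=
  ⟨Subsingleton.elim _ _, Subsingleton.elim _ _⟩

/-- The functor to the terminal category. -/
def toPoint (A : Type u₁) [Category.{v₁} A] [StarCategory A] : StarFunctor A PointCat.{u} where
  obj _ := point
  map _ := ⟨⟩
  map_star _ := rfl

/-- The linear functor to the terminal category. -/
def toPointLinear (A : Type u₁) [Category.{v₁} A] [CLinStarCategory A] :
    CLinStarFunctor A PointCat.{u} where
  toStarFunctor := toPoint A
  map_add _ _ := rfl
  map_smul _ _ := rfl

instance : IsPreCStar.{v} PointCat.{u} where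
  maxNorm_lt_top f := by
    rw [Subsingleton.elim f 0, maxNorm_zero]
    exact ENNReal.zero_lt_top

instance (a b : PointCat.{u}) : Subsingleton (NHom a b) :=
  ⟨fun f g => congrArg NHom.mk (Subsingleton.elim f.hom g.hom)⟩

instance : IsCStar.{v} PointCat.{u} where
  eq_zero_of_norm _ _ := Subsingleton.elim _ _
  complete _ _ := inferInstance

end PointCat

section Terminal

open Limits

instance : HasTerminal StarCat.{v, u} :=
  (IsTerminal.ofUniqueHom (Y := (⟨PointCat.{u}⟩ : StarCat.{v, u}))
    (fun A => PointCat.toPoint A.carrier)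
    (fun _ _ => StarFunctor.ext' (PointCat.functor_ext _ _))).hasTerminal

instance : HasTerminal MStarCat.{v, u} :=
  (IsTerminal.ofUniqueHom (Y := (⟨PointCat.{u}, Marking.max _⟩ : MStarCat.{v, u}))
    (fun A => ({ PointCat.toPoint A.carrier with
      map_marked := fun _ _ => PointCat.isUnitary _ } : MStarCat.Hom _ _))
    (fun _ _ => MStarCat.hom_ext (PointCat.functor_ext _ _))).hasTerminal

/-- The terminal `ℂ`-linear `*`-category. -/
def CLinStarCat.isTerminalPoint : IsTerminal (⟨PointCat.{u}⟩ : CLinStarCat.{v, u}) :=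
  IsTerminal.ofUniqueHom (fun A => PointCat.toPointLinear A.carrier)
    (fun _ _ => CLinStarFunctor.ext' (PointCat.functor_ext _ _))

/-- The terminal marked `ℂ`-linear `*`-category. -/
def MCLinStarCat.isTerminalPoint :
    IsTerminal (⟨PointCat.{u}, Marking.max _⟩ : MCLinStarCat.{v, u}) :=
  IsTerminal.ofUniqueHom
    (fun A => ({ PointCat.toPointLinear A.carrier with
      map_marked := fun _ _ => PointCat.isUnitary _ } : MCLinStarCat.Hom _ _))
    (fun _ _ => MCLinStarCat.hom_ext (PointCat.functor_ext _ _))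

instance : HasTerminal CLinStarCat.{v, u} := CLinStarCat.isTerminalPoint.hasTerminal

instance : HasTerminal MCLinStarCat.{v, u} := MCLinStarCat.isTerminalPoint.hasTerminal

theorem CategoryTheory.ObjectProperty.hasTerminal_fullSubcategory {C : Type u} [Category.{v} C]
    (P : ObjectProperty C) {X : C} (hX : IsTerminal X) (h : P X) :
    HasTerminal P.FullSubcategory :=
  (IsTerminal.isTerminalOfObj P.ι (⟨X, h⟩ : P.FullSubcategory) hX).hasTerminal

instance : HasTerminal PreCStarCat.{v, u} :=
  ObjectProperty.hasTerminal_fullSubcategory _ CLinStarCat.isTerminalPoint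
    (inferInstanceAs (IsPreCStar PointCat))

instance : HasTerminal CStarCat.{v, u} :=
  ObjectProperty.hasTerminal_fullSubcategory _ CLinStarCat.isTerminalPoint
    (inferInstanceAs (IsCStar PointCat))

instance : HasTerminal MPreCStarCat.{v, u} :=
  ObjectProperty.hasTerminal_fullSubcategory _ MCLinStarCat.isTerminalPoint
    (inferInstanceAs (IsPreCStar PointCat))

instance : HasTerminal MCStarCat.{v, u} :=
  ObjectProperty.hasTerminal_fullSubcategory _ MCLinStarCat.isTerminalPoint
    (inferInstanceAs (IsCStar PointCat))

end Terminal

/-! ### Marking all unitary morphisms -/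

instance : StarCat.ma.{v, u}.Full := ⟨fun F => ⟨F.toStarFunctor, rfl⟩⟩

instance : StarCat.ma.{v, u}.Faithful :=
  ⟨fun {A B _ _} h => congrArg
    (fun K : StarCat.ma.obj A ⟶ StarCat.ma.obj B => MStarCat.Hom.toStarFunctor K) h⟩

instance : CLinStarCat.ma.{v, u}.Full := ⟨fun F => ⟨F.toCLinStarFunctor, rfl⟩⟩

instance : CLinStarCat.ma.{v, u}.Faithful :=
  ⟨fun {A B _ _} h => congrArg
    (fun K : CLinStarCat.ma.obj A ⟶ CLinStarCat.ma.obj B => MCLinStarCat.Hom.toCLinStarFunctor K) h⟩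

/-- All unitary morphisms are marked. -/
def Marking.IsMaximal {A : Type u} [Category.{v} A] [StarCategory A] (M : Marking A) : Prop :=
  ∀ {a b : A} (f : a ⟶ b), IsUnitary f → M.marked f

theorem Marking.isMaximal_max (A : Type u) [Category.{v} A] [StarCategory A] :
    (Marking.max A).IsMaximal := fun _ h => h

/-- Composition and involution are componentwise, so a unitary transformation has unitary
components. -/
theorem UFun.isMaximal_marking (K : Type u₂) [Category.{v₂} K] {A : Type u} [Category.{v} A]
    [StarCategory A] {M : Marking A} (hM : M.IsMaximal) : (UFun.marking K M).IsMaximal :=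
  fun _ hf g => hM _
    ⟨congrArg (fun t => NatTrans.app t g) hf.1, congrArg (fun t => NatTrans.app t g) hf.2⟩

theorem MStarCat.isMaximal_of_iso {A B : MStarCat.{v, u}} (e : A ≅ B) (hA : A.marking.IsMaximal) :
    B.marking.IsMaximal := by
  intro a b f hf
  have h : B.marking.marked ((e.inv ≫ e.hom).map f) :=
    e.hom.map_marked _ (hA _ (e.inv.toStarFunctor.map_isUnitary hf))
  rw [e.inv_hom_id] at h
  exact h

/-- The comparison of a marked `*`-category with the one in which all unitaries are marked. -/
def MStarCat.toMaForget : 𝟭 MStarCat.{v, u} ⟶ MStarCat.forget ⋙ StarCat.ma where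
  app A := ({ 𝟭 A.carrier with
    map_star := fun _ => rfl
    map_marked := fun f hf => A.marking.unitary f hf } :
      MStarCat.Hom A (StarCat.ma.obj (MStarCat.forget.obj A)))
  naturality _ _ _ := rfl

theorem MStarCat.isIso_toMaForget {A : MStarCat.{v, u}} (hA : A.marking.IsMaximal) :
    IsIso (MStarCat.toMaForget.app A) :=
  ⟨({ 𝟭 A.carrier with
      map_star := fun _ => rfl
      map_marked := fun f hf => hA f hf } :
      MStarCat.Hom (StarCat.ma.obj (MStarCat.forget.obj A)) A), rfl, rfl⟩

/-- The comparison of a marked `ℂ`-linear `*`-category with the one in which all unitaries are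
marked. -/
def MCLinStarCat.toMaForget : 𝟭 MCLinStarCat.{v, u} ⟶ MCLinStarCat.forget ⋙ CLinStarCat.ma where
  app A := ({ 𝟭 A.carrier with
    map_star := fun _ => rfl
    map_add := fun _ _ => rfl
    map_smul := fun _ _ => rfl
    map_marked := fun f hf => A.marking.unitary f hf } :
      MCLinStarCat.Hom A (CLinStarCat.ma.obj (MCLinStarCat.forget.obj A)))
  naturality _ _ _ := rfl

theorem MCLinStarCat.isIso_toMaForget {A : MCLinStarCat.{v, u}} (hA : A.marking.IsMaximal) :
    IsIso (MCLinStarCat.toMaForget.app A) :=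
  ⟨({ 𝟭 A.carrier with
      map_star := fun _ => rfl
      map_add := fun _ _ => rfl
      map_smul := fun _ _ => rfl
      map_marked := fun f hf => hA f hf } :
      MCLinStarCat.Hom (CLinStarCat.ma.obj (MCLinStarCat.forget.obj A)) A), rfl, rfl⟩

/-- The restriction of `MCLinStarCat.toMaForget` to marked pre-`C*`-categories. -/
def MPreCStarCat.toMaForget : 𝟭 MPreCStarCat.{v, u} ⟶ MPreCStarCat.forget ⋙ PreCStarCat.ma where
  app A := ObjectProperty.homMk (MCLinStarCat.toMaForget.app A.obj)
  naturality _ _ _ := rfl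

/-- The restriction of `MCLinStarCat.toMaForget` to marked `C*`-categories. -/
def MCStarCat.toMaForget : 𝟭 MCStarCat.{v, u} ⟶ MCStarCat.forget ⋙ CStarCat.ma where
  app A := ObjectProperty.homMk (MCLinStarCat.toMaForget.app A.obj)
  naturality _ _ _ := rfl

theorem MPreCStarCat.isIso_toMaForget {A : MPreCStarCat.{v, u}} (hA : A.obj.marking.IsMaximal) :
    IsIso (MPreCStarCat.toMaForget.app A) :=
  have : IsIso ((ObjectProperty.ι _).map (MPreCStarCat.toMaForget.app A)) :=
    MCLinStarCat.isIso_toMaForget hA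
  isIso_of_reflects_iso _ (ObjectProperty.ι _)

theorem MCStarCat.isIso_toMaForget {A : MCStarCat.{v, u}} (hA : A.obj.marking.IsMaximal) :
    IsIso (MCStarCat.toMaForget.app A) :=
  have : IsIso ((ObjectProperty.ι _).map (MCStarCat.toMaForget.app A)) :=
    MCLinStarCat.isIso_toMaForget hA
  isIso_of_reflects_iso _ (ObjectProperty.ι _)

/-! ### `Bd^∞` of a pre-`C*`-category -/

/-- The inclusion of a wide subcategory. -/
def StarSub.incl {A : Type u} [Category.{v} A] [CLinStarCategory A] (S : StarSub A) :
    CLinStarFunctor S.Carrier A where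
  obj a := a.obj
  map f := f.1
  map_id _ := rfl
  map_comp _ _ := rfl
  map_star _ := rfl
  map_add _ _ := rfl
  map_smul _ _ := rfl

/-- A pre-`C*`-category is isomorphic to its `Bd^∞`. -/
def MCLinStarCat.bdInfIso (A : MCLinStarCat.{v, u}) (h : IsPreCStar A.carrier) :
    A ≅ MCLinStarCat.bdInf.obj A where
  hom := MCLinStarCat.toBdInf A
  inv := ({ StarSub.incl (StarSub.bdInf A.carrier) with map_marked := fun _ hf => hf } :
    MCLinStarCat.Hom (MCLinStarCat.bdInf.obj A) A)
  hom_inv_id := rfl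
  inv_hom_id := rfl

/-- On pre-`C*`-categories, `Fun^bd` is identified with `Fun^u`. -/
def MPreCStarCat.funTildeComparison (G : Type v) [Group G] :
    (MPreCStarCat.funTilde.{v, u} G).Comparison (ObjectProperty.ι _)
      (MCLinStarCat.funTilde.{v, u} G) where
  iso i := NatIso.ofComponents
    (fun A => MCLinStarCat.bdInfIso (((MCLinStarCat.funTilde.{v, u} G).act.obj i).obj A.obj)
      (UFun.isPreCStar.{v, u} G A.obj.marking))
    (fun _ => rfl)
  act _ _ := rfl
  unit _ _ := rfl

/-! ### Completeness of functor categories -/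

/-- Functors do not increase the maximal norm, so under `hn` the functor is an isometric bijection
on morphism spaces, and both separatedness and completeness are pulled back. No condition on objects
is needed. -/
theorem IsCStar.of_functor {A B : Type u} [Category.{v} A] [CLinStarCategory A]
    [Category.{v} B] [CLinStarCategory B] [IsCStar A] (F : CLinStarFunctor B A)
    (hF : ∀ a b : B, Function.Bijective (fun f : a ⟶ b => F.map f))
    (hn : ∀ {a b : B} (f : a ⟶ b), maxNorm f ≤ maxNorm (F.map f)) : IsCStar B := by
  have hB : IsPreCStar B := ⟨fun f => (hn f).trans_lt (IsPreCStar.maxNorm_lt_top _)⟩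
  have he : ∀ {a b : B} (f : a ⟶ b), maxNorm (F.map f) = maxNorm f := fun f =>
    le_antisymm (maxNorm_map_le F f) (hn f)
  let φ : ∀ a b : B, NHom a b →+ NHom (F.obj a) (F.obj b) := fun a b =>
    AddMonoidHom.mk' (fun f => ⟨F.map f.hom⟩) (fun f g => congrArg NHom.mk (F.map_add f.hom g.hom))
  have hφ : ∀ (a b : B) (f : NHom a b), ‖φ a b f‖ = ‖f‖ := fun a b f =>
    congrArg ENNReal.toReal (he f.hom)
  have hb : ∀ a b, Function.Bijective (φ a b) := fun a b =>
    ⟨fun f g h => congrArg NHom.mk ((hF a b).1 (congrArg NHom.hom h)),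
      fun g => ⟨⟨((hF a b).2 g.hom).choose⟩, congrArg NHom.mk ((hF a b).2 g.hom).choose_spec⟩⟩
  refine { hB with eq_zero_of_norm := fun {a b} f hf => ?_, complete := fun a b => ?_ }
  · refine (hb a b).1 ?_
    rw [map_zero]
    exact IsCStar.eq_zero_of_norm _ ((hφ a b f).trans hf)
  · have hi : Isometry (φ a b) := AddMonoidHomClass.isometry_of_norm _ (hφ a b)
    exact (hi.isUniformInducing.completeSpace_congr (hb a b).2).2 (IsCStar.complete _ _)

/-- Evaluation at the neutral element. -/
def UFun.evOne (G : Type v) [Group G] {A : Type u} [Category.{v₁} A] [CLinStarCategory A]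
    (M : Marking A) : CLinStarFunctor (UFun (GTilde G) M) A where
  obj a := a.toFunctor.obj ⟨1⟩
  map f := NatTrans.app f ⟨1⟩
  map_id _ := rfl
  map_comp _ _ := rfl
  map_star _ := rfl
  map_add _ _ := rfl
  map_smul _ _ := rfl

/-- A transformation is its component at `1` conjugated by the unitaries `h`. Evaluation at `1` is
therefore bijective on morphism spaces, and it does not decrease the maximal norm since unitaries
have norm at most one. -/
theorem UFun.isCStar (G : Type v) [Group G] {A : Type (max v u)} [Category.{v} A]
    [CLinStarCategory A] (M : Marking A) [IsCStar A] : IsCStar (UFun (GTilde G) M) := by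
  let C : CLinStarFunctor A (UFun (GTilde G) M) :=
    (MCLinStarCat.const (GTilde G) (⟨A, M⟩ : MCLinStarCat.{v, max v u})).toCLinStarFunctor
  let h (a : UFun (GTilde G) M) : C.obj (a.toFunctor.obj ⟨1⟩) ⟶ a := a.fromConst
  have hu (a : UFun (GTilde G) M) : IsUnitary (h a) :=
    (UFun.marking (GTilde G) M).unitary _ (fun g => a.marked _)
  have e {a b : UFun (GTilde G) M} (f : a ⟶ b) :
      f = (dag (h a) ≫ C.map (NatTrans.app f ⟨1⟩)) ≫ h b := by
    have hf : h a ≫ f = C.map (NatTrans.app f ⟨1⟩) ≫ h b := UFun.fromConst_comp f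
    rw [Category.assoc, ← hf, ← Category.assoc, (hu a).2, Category.id_comp]
  -- At `1` the conjugating unitary is the value of `a` on an identity, so the transformation built
  -- from `k` evaluates to `k` again.
  have h₁ (a : UFun (GTilde G) M) : NatTrans.app (h a) ⟨1⟩ = 𝟙 (a.toFunctor.obj ⟨1⟩) :=
    a.toFunctor.map_id _
  refine IsCStar.of_functor (UFun.evOne G M) (fun a b => ⟨fun f g hfg => ?_, fun k => ?_⟩)
    (fun {a b} f => ?_)
  · rw [e f, e g]
    exact congrArg (fun k => (dag (h a) ≫ C.map k) ≫ h b) hfg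
  · refine ⟨(dag (h a) ≫ C.map k) ≫ h b, ?_⟩
    change (dag (NatTrans.app (h a) ⟨1⟩) ≫ k) ≫ NatTrans.app (h b) ⟨1⟩ = k
    have key : ∀ {x y : A} (s : x ⟶ x) (t : y ⟶ y) (k : x ⟶ y), s = 𝟙 x → t = 𝟙 y →
        (dag s ≫ k) ≫ t = k := by
      rintro x y _ _ k rfl rfl
      rw [StarCategory.dag_id, Category.id_comp, Category.comp_id]
    exact key _ _ k (h₁ a) (h₁ b)
  · conv_lhs => rw [e f]
    calc _ ≤ 1 * (maxNorm (NatTrans.app f ⟨1⟩) * 1) :=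
          (maxNorm_comp_le _ _).trans (mul_le_mul' (maxNorm_unitary_le (hu b))
            ((maxNorm_comp_le _ _).trans (mul_le_mul' (maxNorm_map_le C _)
              (maxNorm_unitary_le (hu a).star))))
      _ = maxNorm (NatTrans.app f ⟨1⟩) := by rw [one_mul, mul_one]

/-- All morphisms are bounded, so the inclusion is bijective on morphisms, and its inverse functor
does not increase the maximal norm. -/
theorem StarSub.isCStar_bdInf {A : Type u} [Category.{v} A] [CLinStarCategory A] [IsCStar A] :
    IsCStar (StarSub.bdInf A).Carrier :=
  IsCStar.of_functor (StarSub.incl (StarSub.bdInf A))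
    (fun _ _ => ⟨fun _ _ h => Subtype.ext h, fun f => ⟨⟨f, StarSub.mem_bdInf f⟩, rfl⟩⟩)
    (fun {a b} f => maxNorm_map_le (StarSub.lift (StarSub.bdInf A) StarSub.mem_bdInf)
      (a := a.obj) (b := b.obj) f.1)

/-! ### Completion of a `C*`-category -/

namespace CStarCompl

variable {A : Type u} [Category.{v} A] [CLinStarCategory A] [IsCStar A]

/-- The seminorm is a norm, which gives injectivity; the range is complete, hence closed, and also
dense, which gives surjectivity. -/
theorem bijective_coe (a b : A) :
    Function.Bijective ((↑) : NHom a b → Completion (NHom a b)) := by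
  have := IsCStar.complete a b
  constructor
  · intro f g h
    have h' : ‖f - g‖ = 0 := by
      rw [← Completion.norm_coe, Completion.coe_sub, h, sub_self, norm_zero]
    exact sub_eq_zero.1 (IsCStar.eq_zero_of_norm _ h')
  · rw [← Set.range_eq_univ, ← (Completion.denseRange_coe (α := NHom a b)).closure_range]
    exact ((Completion.isUniformInducing_coe _).isComplete_range.isClosed.closure_eq).symm

/-- A `C*`-category has the same morphisms as its completion. -/
noncomputable def coeEquiv (a b : A) : NHom a b ≃ Completion (NHom a b) :=
  Equiv.ofBijective _ (bijective_coe a b)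

theorem coe_coeEquiv_symm {a b : A} (x : Completion (NHom a b)) :
    (((coeEquiv a b).symm x : NHom a b) : Completion (NHom a b)) = x :=
  (coeEquiv a b).apply_symm_apply x

/-- The inverse of the functor from a `C*`-category to its completion. -/
noncomputable def toCStar (A : Type u) [Category.{v} A] [CLinStarCategory A] [IsCStar A] :
    CLinStarFunctor (CStarCompl A) A where
  obj a := a.obj
  map {a b} x := ((coeEquiv a.obj b.obj).symm x).hom
  map_id a := congrArg NHom.hom ((coeEquiv a.obj a.obj).symm_apply_apply ⟨𝟙 a.obj⟩)
  map_comp {a b c} x y := by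
    refine congrArg NHom.hom (a₂ := (⟨_ ≫ _⟩ : NHom a.obj c.obj))
      ((coeEquiv a.obj c.obj).symm_apply_eq.2 (Eq.symm ?_))
    refine (compC_coe _ _).symm.trans ?_
    rw [coe_coeEquiv_symm, coe_coeEquiv_symm]
    rfl
  map_star {a b} x := by
    refine congrArg NHom.hom (a₂ := (⟨dag _⟩ : NHom b.obj a.obj))
      ((coeEquiv b.obj a.obj).symm_apply_eq.2 (Eq.symm ?_))
    refine (dagC_coe _).symm.trans ?_
    rw [coe_coeEquiv_symm]
    rfl
  map_add {a b} x y := by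
    refine congrArg NHom.hom (a₂ := (coeEquiv a.obj b.obj).symm x + (coeEquiv a.obj b.obj).symm y)
      ((coeEquiv a.obj b.obj).symm_apply_eq.2 (Eq.symm ?_))
    refine (Completion.coe_add _ _).trans ?_
    rw [coe_coeEquiv_symm, coe_coeEquiv_symm]
  map_smul {a b} r x := by
    refine congrArg NHom.hom (a₂ := r • (coeEquiv a.obj b.obj).symm x)
      ((coeEquiv a.obj b.obj).symm_apply_eq.2 (Eq.symm ?_))
    refine (Completion.coe_smul _ _).trans ?_
    rw [coe_coeEquiv_symm]

end CStarCompl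

/-- The canonical transformation from a marked pre-`C*`-category to its completion. -/
noncomputable def MPreCStarCat.toCompl :
    𝟭 MPreCStarCat.{v, u} ⟶ MPreCStarCat.compl ⋙ MCStarCat.toMPreCStarCat where
  app A := ObjectProperty.homMk
    ({ CStarCompl.ofPre A.obj.carrier with
      map_marked := fun f hf => ⟨f, hf, rfl⟩ } :
      MCLinStarCat.Hom A.obj ⟨CStarCompl A.obj.carrier, CStarCompl.marking A.obj.marking⟩)
  naturality A B F := by
    refine ObjectProperty.hom_ext _ (MCLinStarCat.hom_ext
      (CategoryTheory.Functor.hext (fun _ => rfl) (fun a b f => heq_of_eq ?_)))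
    exact (CStarCompl.mapC_coe F.hom.toCLinStarFunctor (⟨f⟩ : NHom a b)).symm

/-- The inverse on morphism spaces respects the markings because the marked morphisms of the
completion are by definition the images of the marked ones. -/
theorem MPreCStarCat.isIso_toCompl (A : MPreCStarCat.{v, u}) (hA : IsCStar A.obj.carrier) :
    IsIso (MPreCStarCat.toCompl.app A) := by
  let r : MPreCStarCat.compl.obj A ⟶ (⟨A.obj, hA⟩ : MCStarCat.{v, u}) := ObjectProperty.homMk
    ({ CStarCompl.toCStar A.obj.carrier with
      map_marked := fun {a b} x hx => by
        obtain ⟨f, hf, rfl⟩ := hx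
        have e : ((CStarCompl.coeEquiv a.obj b.obj).symm
            ((⟨f⟩ : NHom a.obj b.obj) : Completion (NHom a.obj b.obj))).hom = f :=
          congrArg NHom.hom ((CStarCompl.coeEquiv a.obj b.obj).symm_apply_apply ⟨f⟩)
        exact (congrArg A.obj.marking.marked e).mpr hf } :
      MCLinStarCat.Hom ⟨CStarCompl A.obj.carrier, CStarCompl.marking A.obj.marking⟩ A.obj)
  refine ⟨MCStarCat.toMPreCStarCat.map r, ?_, ?_⟩
  · refine ObjectProperty.hom_ext _ (MCLinStarCat.hom_ext
      (CategoryTheory.Functor.hext (fun _ => rfl) (fun a b f => heq_of_eq ?_)))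
    exact congrArg NHom.hom ((CStarCompl.coeEquiv (A := A.obj.carrier) a b).symm_apply_apply ⟨f⟩)
  · refine ObjectProperty.hom_ext _ (MCLinStarCat.hom_ext
      (CategoryTheory.Functor.hext (fun _ => rfl) (fun a b x => heq_of_eq ?_)))
    exact CStarCompl.coe_coeEquiv_symm (A := A.obj.carrier) (a := a.obj) (b := b.obj) x

/-! ### The eight comparisons -/

section Comparisons

variable (G : Type v) [Group G]

/-- On `C*`-categories, `Fun^{C*}` is identified with `Fun^bd`. -/
noncomputable def MCStarCat.funTildeComparison :
    (MCStarCat.funTilde.{v, u} G).Comparison MCStarCat.toMPreCStarCat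
      (MPreCStarCat.funTilde.{v, u} G) :=
  (MPreCStarCat.funTilde.{v, u} G).conjComparison MPreCStarCat.toCompl (fun _ => rfl)
    -- The completion is inverted only at `Fun^bd` of a `C*`-category, which is already a
    -- `C*`-category.
    (fun i A => MPreCStarCat.isIso_toCompl _ (by
      have := UFun.isCStar.{v, u} G A.obj.marking
      exact StarSub.isCStar_bdInf (A := UFun (GTilde G) A.obj.marking)))

/-- Maximality is transported from `Fun^u` along the comparison isomorphism, so the markings on
`Bd^∞` and on the completion need no separate analysis. -/
theorem GFunctor.Comparison.isMaximal {C : Type u₁} [Category.{v₁} C] {T : GFunctor G C}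
    {V : C ⥤ MStarCat.{v, max v u}} (c : T.Comparison V (MStarCat.funTilde.{v, u} G))
    (i : SingleObj G) {A : C} (hA : (V.obj A).marking.IsMaximal) :
    (V.obj ((T.act.obj i).obj A)).marking.IsMaximal :=
  MStarCat.isMaximal_of_iso ((c.iso i).app A) (UFun.isMaximal_marking _ hA)

/-- The comparison for marked pre-`C*`-categories. -/
def MPreCStarCat.comparison : (MPreCStarCat.funTilde.{v, u} G).Comparison
    (ObjectProperty.ι _ ⋙ MCLinStarCat.toMStarCat) (MStarCat.funTilde.{v, u} G) :=
  (MPreCStarCat.funTildeComparison.{v, u} G).comp (MCLinStarCat.funTildeComparison.{v, u} G)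

/-- The comparison for marked `C*`-categories. -/
noncomputable def MCStarCat.comparison : (MCStarCat.funTilde.{v, u} G).Comparison
    (ObjectProperty.ι _ ⋙ MCLinStarCat.toMStarCat) (MStarCat.funTilde.{v, u} G) :=
  (MCStarCat.funTildeComparison.{v, u} G).comp (MPreCStarCat.comparison.{v, u} G)

/-- The comparison for `*`-categories. -/
noncomputable def StarCat.comparison : (StarCat.funTilde.{v, u} G).Comparison StarCat.ma
    (MStarCat.funTilde.{v, u} G) :=
  (MStarCat.funTilde.{v, u} G).conjComparison MStarCat.toMaForget (fun _ => rfl)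
    (fun _ A => MStarCat.isIso_toMaForget
      (UFun.isMaximal_marking _ (Marking.isMaximal_max A.carrier)))

/-- The comparison for `ℂ`-linear `*`-categories. -/
noncomputable def CLinStarCat.comparison : (CLinStarCat.funTilde.{v, u} G).Comparison
    (CLinStarCat.ma ⋙ MCLinStarCat.toMStarCat) (MStarCat.funTilde.{v, u} G) :=
  ((MCLinStarCat.funTilde.{v, u} G).conjComparison MCLinStarCat.toMaForget (fun _ => rfl)
    (fun _ A => MCLinStarCat.isIso_toMaForget
      (UFun.isMaximal_marking _ (Marking.isMaximal_max A.carrier)))).comp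
    (MCLinStarCat.funTildeComparison.{v, u} G)

/-- The comparison for pre-`C*`-categories. -/
noncomputable def PreCStarCat.comparison : (PreCStarCat.funTilde.{v, u} G).Comparison
    (ObjectProperty.ι _ ⋙ CLinStarCat.ma ⋙ MCLinStarCat.toMStarCat)
    (MStarCat.funTilde.{v, u} G) :=
  ((MPreCStarCat.funTilde.{v, u} G).conjComparison MPreCStarCat.toMaForget (fun _ => rfl)
    (fun i A => MPreCStarCat.isIso_toMaForget
      ((MPreCStarCat.comparison.{v, u} G).isMaximal.{v, u} G i (A := PreCStarCat.ma.obj A)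
        (Marking.isMaximal_max A.obj.carrier)))).comp
    (MPreCStarCat.comparison.{v, u} G)

/-- The comparison for `C*`-categories. -/
noncomputable def CStarCat.comparison : (CStarCat.funTilde.{v, u} G).Comparison
    (ObjectProperty.ι _ ⋙ CLinStarCat.ma ⋙ MCLinStarCat.toMStarCat)
    (MStarCat.funTilde.{v, u} G) :=
  ((MCStarCat.funTilde.{v, u} G).conjComparison MCStarCat.toMaForget (fun _ => rfl)
    (fun i A => MCStarCat.isIso_toMaForget
      ((MCStarCat.comparison.{v, u} G).isMaximal.{v, u} G i (A := CStarCat.ma.obj A)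
        (Marking.isMaximal_max A.obj.carrier)))).comp
    (MCStarCat.comparison.{v, u} G)

/-- The comparison of `Fun^u` with itself. -/
def MStarCat.comparison : (MStarCat.funTilde.{v, u} G).Comparison (𝟭 MStarCat.{v, max v u})
    (MStarCat.funTilde.{v, u} G) where
  iso i := Iso.refl ((MStarCat.funTilde.{v, u} G).act.obj i)
  act _ _ := rfl
  unit _ _ := rfl

end Comparisons

/-! ### The eight cases -/

theorem mainTheorem10 (G : Type v) [Group G] :
    IsInjectiveFibrantReplacement StarCat.ma.{v, max v u}
      (StarCat.funTilde.{v, u} G).onGObjects (StarCat.funTilde.{v, u} G).unitOnGObjects ∧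
    IsInjectiveFibrantReplacement
      (CLinStarCat.ma.{v, max v u} ⋙ MCLinStarCat.toMStarCat)
      (CLinStarCat.funTilde.{v, u} G).onGObjects (CLinStarCat.funTilde.{v, u} G).unitOnGObjects ∧
    IsInjectiveFibrantReplacement
      (ObjectProperty.ι _ ⋙ CLinStarCat.ma.{v, max v u} ⋙ MCLinStarCat.toMStarCat)
      (PreCStarCat.funTilde.{v, u} G).onGObjects (PreCStarCat.funTilde.{v, u} G).unitOnGObjects ∧
    IsInjectiveFibrantReplacement
      (ObjectProperty.ι _ ⋙ CLinStarCat.ma.{v, max v u} ⋙ MCLinStarCat.toMStarCat)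
      (CStarCat.funTilde.{v, u} G).onGObjects (CStarCat.funTilde.{v, u} G).unitOnGObjects ∧
    IsInjectiveFibrantReplacement (𝟭 MStarCat.{v, max v u})
      (MStarCat.funTilde.{v, u} G).onGObjects (MStarCat.funTilde.{v, u} G).unitOnGObjects ∧
    IsInjectiveFibrantReplacement MCLinStarCat.toMStarCat.{v, max v u}
      (MCLinStarCat.funTilde.{v, u} G).onGObjects
      (MCLinStarCat.funTilde.{v, u} G).unitOnGObjects ∧
    IsInjectiveFibrantReplacement
      (ObjectProperty.ι _ ⋙ MCLinStarCat.toMStarCat.{v, max v u})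
      (MPreCStarCat.funTilde.{v, u} G).onGObjects (MPreCStarCat.funTilde.{v, u} G).unitOnGObjects ∧
    IsInjectiveFibrantReplacement
      (ObjectProperty.ι _ ⋙ MCLinStarCat.toMStarCat.{v, max v u})
      (MCStarCat.funTilde.{v, u} G).onGObjects (MCStarCat.funTilde.{v, u} G).unitOnGObjects := by
  -- Shared by the three unmarked linear cases, the last two of which only add the inclusion of a
  -- full subcategory.
  have hC : LiftsMarkedEquivalences
      (CLinStarCat.ma.{v, max v u} ⋙ MCLinStarCat.toMStarCat) :=
    MCLinStarCat.liftsMarkedEquivalences_toMStarCat.comp CLinStarCat.ma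
  exact ⟨(StarCat.comparison.{v, u} G).isInjectiveFibrantReplacement.{v, u}
      (LiftsMarkedEquivalences.id.comp StarCat.ma),
    (CLinStarCat.comparison.{v, u} G).isInjectiveFibrantReplacement.{v, u} hC,
    (PreCStarCat.comparison.{v, u} G).isInjectiveFibrantReplacement.{v, u} (hC.comp _),
    (CStarCat.comparison.{v, u} G).isInjectiveFibrantReplacement.{v, u} (hC.comp _),
    (MStarCat.comparison.{v, u} G).isInjectiveFibrantReplacement.{v, u} .id,
    (MCLinStarCat.funTildeComparison.{v, u} G).isInjectiveFibrantReplacement.{v, u}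
      MCLinStarCat.liftsMarkedEquivalences_toMStarCat,
    (MPreCStarCat.comparison.{v, u} G).isInjectiveFibrantReplacement.{v, u}
      (MCLinStarCat.liftsMarkedEquivalences_toMStarCat.comp _),
    (MCStarCat.comparison.{v, u} G).isInjectiveFibrantReplacement.{v, u}
      (MCLinStarCat.liftsMarkedEquivalences_toMStarCat.comp _)⟩
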